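/- Let $X$ be a closed (compact, connected) Riemann surface, $L\to X$ a holomorphic line bundle, and let $(W,\Phi)$ be an $L$-twisted $\operatorname{SL}(n,\mathbb C)$-Higgs pair: $W$ is a holomorphic vector bundle of rank $n$ on $X$ with a trivialization $\det W\simeq\mathcal O$, and $\Phi\in H^0(X,L\otimes\operatorname{End}_0W)$, where $\operatorname{End}_0 W$ is the bundle of traceless endomorphisms. For a filtration $\mathcal W=(0=W_0\subsetneq W_1\subsetneq\dots\subsetneq W_k=W)$ by holomorphic subbundles let $$\Lambda(\mathcal W)=\Big\{(\lambda_1,\dots,\lambda_k)\in\mathbb R^k \;\Big|\; \lambda_1\le\dots\le\lambda_k,\ \sum_{i=1}^{k}\operatorname{rk}W_i\,(\lambda_i-\lambda_{i+1})=0\Big\},\qquad \lambda_{k+1}:=0,$$ (so the last condition reads $\sum_i\lambda_i\operatorname{rk}(W_i/W_{i-1})=0$), and for $\lambda\in\Lambda(\mathcal W)$ put $$N(\mathcal W,\lambda)=L\otimes\operatorname{End}_0W\ \cap\sum_{\lambda_i\ge\lambda_j}L\otimes\operatorname{Hom}(W/W_{i-1},W_j)\subset L\otimes \operatorname{End}W,\qquad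 d(\mathcal W,\lambda)=\sum_{j=1}^{k-1}(\lambda_j-\lambda_{j+1})\deg W_j ,$$ where $\operatorname{Hom}(W/W_{i-1},W_j)$ is the bundle of endomorphisms of $W$ that vanish on $W_{i-1}$ and have image in $W_j$. The pair $(W,\Phi)$ is called * *semistable* if $d(\mathcal W,\lambda)\ge 0$ for all $\mathcal W$ and all $\lambda\in\Lambda(\mathcal W)$ with $\Phi\in H^0(N(\mathcal W,\lambda))$; * *stable* if it is semistable and $d(\mathcal W,\lambda)>0$ for all $\mathcal W$ and all $\lambda\in\Lambda(\mathcal W)$, not identically zero, with $\Phi\in H^0(N(\mathcal W,\lambda))$; * *polystable* if it is semistable and, for all $\mathcal W$ and all $\lambda\in\Lambda(\mathcal W)$ with $\lambda_1<\dots<\lambda_k$, $\Phi\in H^0(N(\mathcal W,\lambda))$ and $d(\mathcal W,\lambda)=0$, there is a holomorphic isomorphism $W\simeq W_1\oplus W_2/W_1\oplus\dots\oplus W_k/W_{k-1}$ splitting the filtration (it respects the filtrations and induces the identity on every quotient $W_i/W_{i-1}$) with respect to which $\Phi\in H^0\big(\bigoplus_i L\otimes\operatorname{Hom}(W_i/W_{i-1},W_i/W_{i-1})\big)$.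 A holomorphic subbundle $W'\subset W$ is called $\Phi$-invariant if $\Phi(W')\subset L\otimes W'$. **Theorem.** 1. $(W,\Phi)$ is semistable if and only if $\deg W'\le 0$ for every $\Phi$-invariant holomorphic subbundle $W'\subset W$. 2. $(W,\Phi)$ is stable if and only if $\deg W'<0$ for every $\Phi$-invariant holomorphic subbundle $W'\subset W$ with $W'\ne 0$ and $W'\neq W$. 3. $(W,\Phi)$ is polystable if and only if it is semistable and for every $\Phi$-invariant holomorphic subbundle $W'\subset W$ with $\deg W'=0$ there is a $\Phi$-invariant holomorphic subbundle $W''\subset W$ with $W=W'\oplus W''$. -/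

import Mathlib

open scoped Manifold ContDiff TensorProduct
open Bundle

noncomputable section

namespace SLHiggs

section Bundles

variable {X : Type*} [TopologicalSpace X] [ChartedSpace ℂ X]

/-- The section `σ` of the bundle `W` is holomorphic on the set `U` (used for open `U`; over `ℂ`,
holomorphic and analytic are the same). -/
def HolomorphicSectionOn (F : Type*) [NormedAddCommGroup F] [NormedSpace ℂ F]
    {W : X → Type*} [∀ x, TopologicalSpace (W x)] [TopologicalSpace (TotalSpace F W)]
    [FiberBundle F W] (σ : ∀ x, W x) (U : Set X) : Prop :=
  ContMDiffOn 𝓘(ℂ, ℂ) (𝓘(ℂ, ℂ).prod 𝓘(ℂ, F)) ω (fun x => TotalSpace.mk' F x (σ x)) U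

variable (F : Type*) [NormedAddCommGroup F] [NormedSpace ℂ F]
  (W : X → Type*) [∀ x, AddCommGroup (W x)] [∀ x, Module ℂ (W x)]
  [∀ x, TopologicalSpace (W x)] [TopologicalSpace (TotalSpace F W)] [FiberBundle F W]

/-- A holomorphic subbundle of constant rank: a family of subspaces of the fibres of `W` which
is locally spanned by a holomorphic frame. -/
structure HolSubbundle where
  /-- the fibre over `x` -/
  fiber : ∀ x, Submodule ℂ (W x)
  /-- the rank -/
  rank : ℕ
  exists_frame : ∀ x₀ : X, ∃ U : Set X, IsOpen U ∧ x₀ ∈ U ∧ ∃ s : Fin rank → ∀ x, W x,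
    (∀ i, HolomorphicSectionOn F (s i) U) ∧
    ∀ x ∈ U, LinearIndependent ℂ (fun i => s i x) ∧
      Submodule.span ℂ (Set.range fun i => s i x) = fiber x

variable {F W}

/-- Subbundles are ordered by inclusion of their fibres. -/
instance : Preorder (HolSubbundle F W) := Preorder.lift HolSubbundle.fiber

namespace HolSubbundle

/-- `s` is a holomorphic frame of the subbundle `S` over the open set `U`. -/
def IsFrameOn (S : HolSubbundle F W) (U : Set X) (s : Fin S.rank → ∀ x, S.fiber x) : Prop :=
  IsOpen U ∧ (∀ i, HolomorphicSectionOn F (fun x => (s i x : W x)) U) ∧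
    ∀ x ∈ U, LinearIndependent ℂ (fun i => s i x)

/-- Let `η` be a family of alternating forms of top degree on the fibres of `S`, that is, a section
of the line bundle `(det S)^*`. `HasDivisor S η D` says that `η` is a meromorphic section which
vanishes identically near no point, and that `D x` is its order at `x`, for every `x`. Both are
read off in a chart at `x` from the function obtained by evaluating `η` on a local holomorphic
frame of `S`. -/
def HasDivisor (S : HolSubbundle F W)
    (η : ∀ x, (S.fiber x) [⋀^Fin S.rank]→ₗ[ℂ] ℂ) (D : X → ℤ) : Prop :=
  ∀ (U : Set X) (s : Fin S.rank → ∀ x, S.fiber x), S.IsFrameOn U s → ∀ x ∈ U,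
    let f : ℂ → ℂ := fun z => η ((chartAt ℂ x).symm z) fun i => s i ((chartAt ℂ x).symm z)
    MeromorphicAt f (chartAt ℂ x x) ∧ meromorphicOrderAt f (chartAt ℂ x x) = (D x : WithTop ℤ)

/-- `d` is minus the degree of the divisor of a nonzero meromorphic section of `(det S)^*`. -/
def IsDegree (S : HolSubbundle F W) (d : ℤ) : Prop :=
  ∃ (η : ∀ x, (S.fiber x) [⋀^Fin S.rank]→ₗ[ℂ] ℂ) (D : X → ℤ),
    S.HasDivisor η D ∧ d = -∑ᶠ x, D x

open Classical in
/-- The degree of a holomorphic subbundle over a closed Riemann surface: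
`deg S = deg (det S) = -deg ((det S)^*)`, where the degree of a line bundle is the degree of the
divisor of any nonzero meromorphic section. (Over a closed Riemann surface every holomorphic line
bundle has such a section, and the degree of its divisor does not depend on it.) -/
def degree (S : HolSubbundle F W) : ℤ :=
  if h : ∃ d, S.IsDegree d then h.choose else 0

end HolSubbundle

/-- A trivialization `det W ≃ 𝒪`: a family of linear isomorphisms from the top exterior powers of
the fibres to `ℂ`, given as nonzero alternating forms of top degree, holomorphic in the sense
that they take holomorphic local sections to holomorphic functions. -/
structure DetTrivialization (F : Type*) [NormedAddCommGroup F] [NormedSpace ℂ F]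
    (W : X → Type*) [∀ x, AddCommGroup (W x)] [∀ x, Module ℂ (W x)]
    [∀ x, TopologicalSpace (W x)] [TopologicalSpace (TotalSpace F W)] [FiberBundle F W] where
  /-- the alternating form on the fibre over `x` -/
  form : ∀ x, (W x) [⋀^Fin (Module.finrank ℂ F)]→ₗ[ℂ] ℂ
  form_ne_zero : ∀ x, form x ≠ 0
  holomorphic : ∀ (U : Set X), IsOpen U → ∀ s : Fin (Module.finrank ℂ F) → ∀ x, W x,
    (∀ i, HolomorphicSectionOn F (s i) U) →
      ContMDiffOn 𝓘(ℂ, ℂ) 𝓘(ℂ, ℂ) ω (fun x => form x fun i => s i x) U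

/-- `A` is holomorphic on `U` as a section of `End W`. -/
def HolomorphicEndOn (F : Type*) [NormedAddCommGroup F] [NormedSpace ℂ F]
    {W : X → Type*} [∀ x, AddCommGroup (W x)] [∀ x, Module ℂ (W x)]
    [∀ x, TopologicalSpace (W x)] [TopologicalSpace (TotalSpace F W)] [FiberBundle F W]
    (A : ∀ x, Module.End ℂ (W x)) (U : Set X) : Prop :=
  ∀ V ⊆ U, IsOpen V → ∀ σ : ∀ x, W x, HolomorphicSectionOn F σ V →
    HolomorphicSectionOn F (fun x => A x (σ x)) V

end Bundles

section Fibre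

variable {ℓ V : Type*} [AddCommGroup ℓ] [Module ℂ ℓ] [AddCommGroup V] [Module ℂ V]

/-- The subspace `ℓ ⊗ M` of `ℓ ⊗ V`, for a subspace `M` of `V`. -/
def tensorSub (ℓ : Type*) [AddCommGroup ℓ] [Module ℂ ℓ] (M : Submodule ℂ V) :
    Submodule ℂ (ℓ ⊗[ℂ] V) :=
  LinearMap.range (LinearMap.lTensor ℓ M.subtype)

/-- The value at `w` of a twisted endomorphism: `(l ⊗ A) w = l ⊗ A w`. -/
def twistedApply (φ : ℓ ⊗[ℂ] Module.End ℂ V) (w : V) : ℓ ⊗[ℂ] V :=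
  LinearMap.lTensor ℓ (LinearMap.applyₗ w : Module.End ℂ V →ₗ[ℂ] V) φ

/-- `φ(M) ⊆ ℓ ⊗ M`. -/
def TwistedInvariant (φ : ℓ ⊗[ℂ] Module.End ℂ V) (M : Submodule ℂ V) : Prop :=
  ∀ w ∈ M, twistedApply φ w ∈ tensorSub ℓ M

/-- `ℓ ⊗ End₀ V`: the kernel of `id ⊗ trace`. -/
def twistedTraceless (ℓ V : Type*) [AddCommGroup ℓ] [Module ℂ ℓ] [AddCommGroup V] [Module ℂ V] :
    Submodule ℂ (ℓ ⊗[ℂ] Module.End ℂ V) :=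
  LinearMap.ker (LinearMap.lTensor ℓ (LinearMap.trace ℂ V))

/-- The subspace `Hom(V/M, M')` of `End V`: endomorphisms which vanish on `M` and have image
in `M'`. -/
def homSub (M M' : Submodule ℂ V) : Submodule ℂ (Module.End ℂ V) where
  carrier := {f | (∀ v ∈ M, f v = 0) ∧ ∀ v, f v ∈ M'}
  add_mem' := fun ha hb => ⟨fun v hv => by simp [ha.1 v hv, hb.1 v hv],
    fun v => M'.add_mem (ha.2 v) (hb.2 v)⟩
  zero_mem' := ⟨fun _ _ => rfl, fun _ => M'.zero_mem⟩
  smul_mem' := fun c _ ha => ⟨fun v hv => by simp [ha.1 v hv], fun v => M'.smul_mem c (ha.2 v)⟩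

end Fibre

section Pairs

variable {X : Type*} [TopologicalSpace X] [ChartedSpace ℂ X]

/-- An `L`-twisted `SL(n, ℂ)`-Higgs pair with underlying holomorphic vector bundle `W` (whose rank
`n` is the dimension of the model fibre `F`): a trivialization of `det W` and a holomorphic section
of `L ⊗ End₀ W`. A section of `L ⊗ End W` is holomorphic if it can be written locally as `l ⊗ A`
with `l` a holomorphic section of the line bundle `L` and `A` one of `End W`. -/
structure HiggsPair (F : Type*) [NormedAddCommGroup F] [NormedSpace ℂ F]
    (W : X → Type*) [∀ x, AddCommGroup (W x)] [∀ x, Module ℂ (W x)]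
    [∀ x, TopologicalSpace (W x)] [TopologicalSpace (TotalSpace F W)] [FiberBundle F W]
    (L : X → Type*) [∀ x, AddCommGroup (L x)] [∀ x, Module ℂ (L x)]
    [∀ x, TopologicalSpace (L x)] [TopologicalSpace (TotalSpace ℂ L)] [FiberBundle ℂ L] where
  /-- the trivialization of `det W` -/
  det : DetTrivialization F W
  /-- the Higgs field -/
  field : ∀ x, L x ⊗[ℂ] Module.End ℂ (W x)
  traceless : ∀ x, field x ∈ twistedTraceless (L x) (W x)
  holomorphic : ∀ x₀ : X, ∃ U : Set X, IsOpen U ∧ x₀ ∈ U ∧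
    ∃ (l : ∀ x, L x) (A : ∀ x, Module.End ℂ (W x)),
      HolomorphicSectionOn ℂ l U ∧ HolomorphicEndOn F A U ∧ ∀ x ∈ U, field x = l x ⊗ₜ[ℂ] A x

/-- A filtration `0 = W₀ ⊊ W₁ ⊊ ⋯ ⊊ W_k = W` by holomorphic subbundles. Only the values
`sub 0, …, sub k` matter. -/
structure Filtration (F : Type*) [NormedAddCommGroup F] [NormedSpace ℂ F]
    (W : X → Type*) [∀ x, AddCommGroup (W x)] [∀ x, Module ℂ (W x)]
    [∀ x, TopologicalSpace (W x)] [TopologicalSpace (TotalSpace F W)] [FiberBundle F W] where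
  /-- the length -/
  k : ℕ
  /-- the subbundle `W_i` -/
  sub : ℕ → HolSubbundle F W
  bot : (sub 0).fiber = ⊥
  top : (sub k).fiber = ⊤
  strict : ∀ i < k, sub i < sub (i + 1)

variable {F : Type*} [NormedAddCommGroup F] [NormedSpace ℂ F]
  {W : X → Type*} [∀ x, AddCommGroup (W x)] [∀ x, Module ℂ (W x)]
  [∀ x, TopologicalSpace (W x)] [TopologicalSpace (TotalSpace F W)] [FiberBundle F W]
  {L : X → Type*} [∀ x, AddCommGroup (L x)] [∀ x, Module ℂ (L x)]
  [∀ x, TopologicalSpace (L x)] [TopologicalSpace (TotalSpace ℂ L)] [FiberBundle ℂ L]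

namespace Filtration

variable (𝒲 : Filtration F W)

/-- The set `Λ(𝒲)` of weights `λ₁ ≤ ⋯ ≤ λ_k` with `∑_{i=1}^k rk W_i (λ_i - λ_{i+1}) = 0`, where
`λ_{k+1} = 0`; the sum is `∑ λ_i rk (W_i / W_{i-1})`, the trace of the corresponding diagonal
matrix. Only the values `lam 1, …, lam k` matter. -/
def IsWeight (lam : ℕ → ℝ) : Prop :=
  (∀ i ∈ Finset.Ico 1 𝒲.k, lam i ≤ lam (i + 1)) ∧
    ∑ i ∈ Finset.Ico 1 𝒲.k, ((𝒲.sub i).rank : ℝ) * (lam i - lam (i + 1))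
      + ((𝒲.sub 𝒲.k).rank : ℝ) * lam 𝒲.k = 0

/-- The fibre at `x` of `N(𝒲, λ) = L ⊗ End₀ W ∩ ∑_{λ_i ≥ λ_j} L ⊗ Hom(W/W_{i-1}, W_j)`,
`1 ≤ i, j ≤ k`. -/
def N (L : X → Type*) [∀ x, AddCommGroup (L x)] [∀ x, Module ℂ (L x)] (lam : ℕ → ℝ) (x : X) :
    Submodule ℂ (L x ⊗[ℂ] Module.End ℂ (W x)) :=
  twistedTraceless (L x) (W x) ⊓
    ⨆ i ∈ Finset.Icc 1 𝒲.k, ⨆ j ∈ Finset.Icc 1 𝒲.k, ⨆ _ : lam j ≤ lam i,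
      tensorSub (L x) (homSub ((𝒲.sub (i - 1)).fiber x) ((𝒲.sub j).fiber x))

/-- `d(𝒲, λ) = ∑_{j=1}^{k-1} (λ_j - λ_{j+1}) deg W_j`. -/
def d (lam : ℕ → ℝ) : ℝ :=
  ∑ j ∈ Finset.Ico 1 𝒲.k, (lam j - lam (j + 1)) * ((𝒲.sub j).degree : ℝ)

/-- The fibre at `x` of the quotient bundle `W_{i+1} / W_i`. -/
abbrev Gr (i : ℕ) (x : X) : Type _ :=
  ((𝒲.sub (i + 1)).fiber x) ⧸ ((𝒲.sub i).fiber x).submoduleOf ((𝒲.sub (i + 1)).fiber x)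

/-- A holomorphic isomorphism `W₁ ⊕ W₂/W₁ ⊕ ⋯ ⊕ W_k/W_{k-1} ≃ W` splitting the filtration, that
is, a reduction of the structure group from the parabolic subgroup to its Levi factor.
The holomorphic local sections of a quotient bundle are, locally, the classes of holomorphic
sections. -/
structure Splitting where
  /-- the isomorphism over `x` -/
  iso : ∀ x, (∀ i : Fin 𝒲.k, 𝒲.Gr i x) ≃ₗ[ℂ] W x
  holomorphic : ∀ U : Set X, IsOpen U →
    ∀ σ : ∀ i : Fin 𝒲.k, ∀ x, (𝒲.sub (i + 1)).fiber x,
      (∀ i, HolomorphicSectionOn F (fun x => (σ i x : W x)) U) →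
        HolomorphicSectionOn F (fun x => iso x fun i => Submodule.Quotient.mk (σ i x)) U
  /-- the isomorphism respects the filtrations and induces the identity on the quotients -/
  split : ∀ (i : Fin 𝒲.k) (x : X) (w : (𝒲.sub (i + 1)).fiber x),
    iso x (Pi.single i (Submodule.Quotient.mk w)) - (w : W x) ∈ (𝒲.sub i).fiber x

variable {𝒲}

/-- The image in the fibre of `W` at `x` of the summand `W_{i+1} / W_i`. -/
def Splitting.summand (e : 𝒲.Splitting) (i : Fin 𝒲.k) (x : X) : Submodule ℂ (W x) :=
  LinearMap.range ((e.iso x).toLinearMap ∘ₗ LinearMap.single ℂ (fun i : Fin 𝒲.k => 𝒲.Gr i x) i)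

end Filtration

namespace HiggsPair

variable (P : HiggsPair F W L)

/-- `Φ(S) ⊆ L ⊗ S`. -/
def Invariant (S : HolSubbundle F W) : Prop :=
  ∀ x, TwistedInvariant (P.field x) (S.fiber x)

/-- Semistability, in terms of weighted filtrations. -/
def Semistable : Prop :=
  ∀ (𝒲 : Filtration F W) (lam : ℕ → ℝ), 𝒲.IsWeight lam →
    (∀ x, P.field x ∈ 𝒲.N L lam x) → 0 ≤ 𝒲.d lam

/-- Stability, in terms of weighted filtrations. -/
def Stable : Prop :=
  P.Semistable ∧
    ∀ (𝒲 : Filtration F W) (lam : ℕ → ℝ), 𝒲.IsWeight lam →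
      (∃ i ∈ Finset.Icc 1 𝒲.k, lam i ≠ 0) →
      (∀ x, P.field x ∈ 𝒲.N L lam x) → 0 < 𝒲.d lam

/-- Polystability, in terms of weighted filtrations. -/
def Polystable : Prop :=
  P.Semistable ∧
    ∀ (𝒲 : Filtration F W) (lam : ℕ → ℝ), 𝒲.IsWeight lam →
      (∀ i ∈ Finset.Ico 1 𝒲.k, lam i < lam (i + 1)) →
      (∀ x, P.field x ∈ 𝒲.N L lam x) → 𝒲.d lam = 0 →
        ∃ e : 𝒲.Splitting, ∀ i x, TwistedInvariant (P.field x) (e.summand i x)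

end HiggsPair

end Pairs

end SLHiggs

end

/-! Everything rests on two dictionaries between weighted filtrations and invariant subbundles.

From filtrations to subbundles: if the weight jumps at j, that is λ_j < λ_{j+1}, each summand
Hom(W/W_{a-1}, W_b) of N(𝒲, λ) with λ_b ≤ λ_a either kills W_j (when a > j) or maps into W_j (when a
≤ j, which forces b ≤ j). So Φ preserves W_j (`IsWeight.twistedInvariant`). Steps without a jump
contribute nothing to d(𝒲, λ), so d is a combination of degrees of invariant proper subbundles with
negative coefficients. A nonzero weight of trace zero has at least one jump (`IsWeight.exists_lt`).

From subbundles to filtrations: an invariant S of rank r with 0 ≠ S ≠ W gives 0 ⊊ S ⊊ W with weights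
r - n < r. An endomorphism preserving S is one with image in S plus one vanishing on S, so Φ lies in
N, and d = -n deg S.

For polystability, a splitting of the two-step filtration yields an invariant complement of S.
Conversely, d = 0 with strictly increasing weights forces every proper W_i to have degree zero; an
invariant complement T_i of each gives the invariant complement T_i ∩ W_{i+1} of W_i in W_{i+1}, and
the projections onto T_i along W_i assemble to the splitting (`exists_splitting_of_complements`).

The subbundles 0 and W are not steps of such a filtration, and need deg = 0 separately. Both have
trivial determinant, so this reduces to the fact that a meromorphic function on a closed Riemann
surface has as many zeros as poles (`finsum_chartOrder_eq_zero`). For the other subbundles no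
property of the degree is used. -/

noncomputable section

namespace SLHiggs

/-! ### Orders of f - c near a point of the plane, for small c. -/

section LocalDegree
open Filter Topology Polynomial

/-- The order of a nonzero polynomial function at a point is the multiplicity of the root. -/
theorem meromorphicOrderAt_polynomial_eval {p : ℂ[X]} (hp : p ≠ 0) (w : ℂ) :
    meromorphicOrderAt (fun z => p.eval z) w = (p.rootMultiplicity w : ℤ) := by
  obtain ⟨q, hq, hq'⟩ := Polynomial.exists_eq_pow_rootMultiplicity_mul_and_not_dvd p hp w
  have hmer : MeromorphicAt (fun z => p.eval z) w :=
    (AnalyticOnNhd.eval_polynomial p w trivial).meromorphicAt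
  refine (meromorphicOrderAt_eq_int_iff hmer).2
    ⟨fun z => q.eval z, AnalyticOnNhd.eval_polynomial q w trivial, ?_, ?_⟩
  · rwa [Polynomial.dvd_iff_isRoot] at hq'
  · refine Eventually.of_forall fun z => ?_
    conv_lhs => rw [hq]
    simp

/-- Every root of zⁿ = c has modulus |c|^(1/n) < ρ, so the disc contains all n roots counted with
multiplicity. This is the local model for a zero of order n. -/
theorem finite_and_finsum_order_pow_sub_const {n : ℕ} (hn : n ≠ 0) {ρ : ℝ} (hρ : 0 < ρ) {c : ℂ}
    (hc : ‖c‖ < ρ ^ n) :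
    {w : ℂ | (meromorphicOrderAt (fun z => z ^ n - c) w).untop₀ ≠ 0}.Finite ∧
      ∑ᶠ w ∈ Metric.ball (0 : ℂ) ρ, (meromorphicOrderAt (fun z => z ^ n - c) w).untop₀ = n := by
  have hp : (X ^ n - C c : ℂ[X]) ≠ 0 := X_pow_sub_C_ne_zero (Nat.pos_of_ne_zero hn) c
  have hord : ∀ w, (meromorphicOrderAt (fun z => z ^ n - c) w).untop₀ =
      (((X ^ n - C c : ℂ[X]).roots.count w : ℕ) : ℤ) := fun w => by
    have := meromorphicOrderAt_polynomial_eval hp w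
    simp only [eval_sub, eval_pow, eval_X, eval_C] at this
    rw [this, count_roots]; rfl
  have hsub : ∀ w, (meromorphicOrderAt (fun z => z ^ n - c) w).untop₀ ≠ 0 →
      w ∈ (X ^ n - C c : ℂ[X]).roots.toFinset := fun w hw => by
    rw [hord] at hw
    rw [Multiset.mem_toFinset]
    by_contra h
    exact hw (by simp [Multiset.count_eq_zero_of_notMem h])
  refine ⟨(Finset.finite_toSet _).subset hsub, ?_⟩
  rw [finsum_mem_inter_support_eq' _ _ ((X ^ n - C c : ℂ[X]).roots.toFinset : Set ℂ),
    finsum_mem_coe_finset, Finset.sum_congr rfl fun w _ => hord w]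
  · rw [← Nat.cast_sum, Multiset.toFinset_sum_count_eq,
      (IsAlgClosed.splits (X ^ n - C c : ℂ[X])).natDegree_eq_card_roots.symm, natDegree_X_pow_sub_C]
  · intro w hw
    refine ⟨fun _ => hsub w hw, fun _ => ?_⟩
    have h1 := hsub w hw
    rw [Multiset.mem_toFinset, mem_roots hp] at h1
    have h2 : w ^ n = c := by simpa [sub_eq_zero] using h1
    rw [mem_ball_zero_iff]
    refine lt_of_pow_lt_pow_left₀ n hρ.le ?_
    rwa [← norm_pow, h2]

/-- A holomorphic function with a zero of order `n ≥ 1` is the `n`-th power of a local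
coordinate. -/
theorem exists_openPartialHomeomorph_pow_eq {n : ℕ} (hn : n ≠ 0) {u : ℂ → ℂ} {a : ℂ}
    (hu : AnalyticAt ℂ u a) (hua : u a ≠ 0) :
    ∃ H : OpenPartialHomeomorph ℂ ℂ, a ∈ H.source ∧ H a = 0 ∧
      (∀ᶠ z in 𝓝 a, AnalyticAt ℂ H z ∧ deriv H z ≠ 0) ∧
      ∀ᶠ z in 𝓝 a, H z ^ n = (z - a) ^ n * u z := by
  obtain ⟨u₀, hu₀⟩ := IsAlgClosed.exists_pow_nat_eq (u a) (Nat.pos_of_ne_zero hn)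
  have hu₀0 : u₀ ≠ 0 := by
    rintro rfl
    exact hua (by rw [← hu₀, zero_pow hn])
  -- An analytic n-th root of u: dividing by u(a) moves the base of the power close to 1, away from
  -- the branch cut, and u₀ restores the constant. The coordinate is then (z - a) v.
  let v : ℂ → ℂ := fun z => u₀ * (u z / u a) ^ ((n : ℂ)⁻¹)
  have hv : AnalyticAt ℂ v a := by
    refine analyticAt_const.mul ((hu.div analyticAt_const hua).cpow analyticAt_const ?_)
    simp [div_self hua, Complex.one_mem_slitPlane]
  have hva : v a = u₀ := by simp [v, div_self hua]
  let h : ℂ → ℂ := fun z => (z - a) * v z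
  have hh : AnalyticAt ℂ h a := (analyticAt_id.sub analyticAt_const).mul hv
  have hda : HasDerivAt h u₀ a := by
    have h1 := ((hasDerivAt_id a).sub_const a).mul hv.differentiableAt.hasDerivAt
    refine h1.congr_deriv ?_
    simp [hva]
  have hstrict : HasStrictDerivAt h u₀ a := by
    have := hh.hasStrictDerivAt
    rwa [hda.deriv] at this
  have hf := hstrict.hasStrictFDerivAt_equiv hu₀0
  refine ⟨hf.toOpenPartialHomeomorph h, hf.mem_toOpenPartialHomeomorph_source, ?_, ?_, ?_⟩
  · simp [h]
  · rw [HasStrictFDerivAt.toOpenPartialHomeomorph_coe]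
    refine hh.eventually_analyticAt.and (hh.deriv.continuousAt.eventually_ne ?_)
    rwa [hda.deriv]
  · rw [HasStrictFDerivAt.toOpenPartialHomeomorph_coe]
    refine Eventually.of_forall fun z => ?_
    simp only [h, v, mul_pow, hu₀, Complex.cpow_nat_inv_pow _ hn]
    field_simp

theorem eventually_nhdsNE_ne (a y : ℂ) : ∀ᶠ z in 𝓝[≠] y, z ≠ a := by
  rcases eq_or_ne y a with rfl | hya
  · exact self_mem_nhdsWithin
  · exact nhdsWithin_le_nhds (isOpen_ne.mem_nhds hya)

open Classical in
/-- If `f` has no zero at `a`, then near `a` the function `f - c` has neither zeros nor poles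
except possibly at `a`, where it has the same order as `f`, for all small `c`. -/
theorem exists_isOpen_order_sub_const_of_nonpos {f : ℂ → ℂ} {a : ℂ} (hf : MeromorphicAt f a)
    (hord : meromorphicOrderAt f a ≠ ⊤) (hneg : (meromorphicOrderAt f a).untop₀ ≤ 0)
    {V : Set ℂ} (hV : V ∈ 𝓝 a) :
    ∃ U : Set ℂ, IsOpen U ∧ a ∈ U ∧ U ⊆ V ∧ ∀ᶠ c in 𝓝 (0 : ℂ), ∀ y ∈ U,
      (meromorphicOrderAt (fun z => f z - c) y).untop₀ =
        if y = a then (meromorphicOrderAt f a).untop₀ else 0 := by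
  obtain ⟨u, hu, hua, hfu⟩ := (meromorphicOrderAt_ne_top_iff hf).1 hord
  set m := (meromorphicOrderAt f a).untop₀ with hm
  obtain ⟨k, hk⟩ := Int.eq_ofNat_of_zero_le (neg_nonneg.2 hneg)
  have hmk : m = -(k : ℤ) := by omega
  have hu1 : ∀ᶠ z in 𝓝 a, AnalyticAt ℂ u z := hu.eventually_analyticAt
  have hu2 : ∀ᶠ z in 𝓝 a, ‖u a‖ / 2 < ‖u z‖ :=
    hu.continuousAt.norm.eventually (lt_mem_nhds (half_lt_self (norm_pos_iff.2 hua)))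
  -- On the unit disc |c (z - a)^k| ≤ |c|, so this term cannot cancel u once |c| < |u(a)|/2 <
  -- |u(z)|.
  have hz1 : ∀ᶠ z in 𝓝 a, ‖z - a‖ < 1 := by
    filter_upwards [Metric.ball_mem_nhds a one_pos] with z hz
    rwa [← dist_eq_norm]
  have hall := ((hu1.and hu2).and hz1).and
    ((eventually_nhdsWithin_iff.1 hfu).and (Filter.eventually_mem_set.2 hV))
  obtain ⟨O, hO, hOo, haO⟩ := eventually_nhds_iff.1 hall
  refine ⟨O, hOo, haO, fun z hz => (hO z hz).2.2, ?_⟩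
  have hsmall : ∀ᶠ c in 𝓝 (0 : ℂ), ‖c‖ < ‖u a‖ / 2 := by
    filter_upwards [Metric.ball_mem_nhds (0 : ℂ) (half_pos (norm_pos_iff.2 hua))] with c hc
    simpa using hc
  filter_upwards [hsmall] with c hc
  -- `f - c = (z - a) ^ m * g` with `g` analytic and nonvanishing
  let g : ℂ → ℂ := fun z => u z - c * (z - a) ^ k
  have hg : ∀ z ∈ O, AnalyticAt ℂ g z := fun z hz =>
    (hO z hz).1.1.1.sub (analyticAt_const.mul ((analyticAt_id.sub analyticAt_const).pow k))
  have hg0 : ∀ z ∈ O, g z ≠ 0 := fun z hz h => by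
    have h1 : ‖u z‖ ≤ ‖c‖ := by
      rw [sub_eq_zero.1 h, norm_mul, norm_pow]
      exact mul_le_of_le_one_right (norm_nonneg _) (pow_le_one₀ (norm_nonneg _) (hO z hz).1.2.le)
    exact absurd (hc.trans (hO z hz).1.1.2) (not_lt.2 h1)
  have hfg : ∀ z ∈ O, z ≠ a → f z - c = (z - a) ^ m * g z := fun z hz hza => by
    rw [(hO z hz).2.1 hza, hmk]
    simp only [g, smul_eq_mul, zpow_neg, zpow_natCast]
    have : (z - a) ^ k ≠ 0 := pow_ne_zero _ (sub_ne_zero.2 hza)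
    field_simp
  have hfg' : ∀ y ∈ O, (fun z => f z - c) =ᶠ[𝓝[≠] y] (fun z => (z - a) ^ m * g z) := by
    intro y hy
    have e1 : ∀ᶠ z in 𝓝[≠] y, z ∈ O := nhdsWithin_le_nhds (hOo.mem_nhds hy)
    have e2 := eventually_nhdsNE_ne a y
    filter_upwards [e1, e2] with z h1 h2 using hfg z h1 h2
  have hzero : ∀ y ∈ O, y ≠ a → (meromorphicOrderAt (fun z => f z - c) y).untop₀ = 0 := by
    intro y hy hya
    rw [meromorphicOrderAt_congr (hfg' y hy)]
    have hA : AnalyticAt ℂ (fun z => (z - a) ^ m * g z) y :=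
      ((analyticAt_id.sub analyticAt_const).zpow (sub_ne_zero.2 hya)).mul (hg y hy)
    rw [hA.meromorphicOrderAt_eq, hA.analyticOrderAt_eq_zero.2
      (mul_ne_zero (zpow_ne_zero _ (sub_ne_zero.2 hya)) (hg0 y hy))]
    simp
  have hata : (meromorphicOrderAt (fun z => f z - c) a).untop₀ = m := by
    have : meromorphicOrderAt (fun z => f z - c) a = m := by
      refine (meromorphicOrderAt_eq_int_iff (hf.sub (MeromorphicAt.const c a))).2
        ⟨g, hg a haO, hg0 a haO, ?_⟩
      exact hfg' a haO
    rw [this]; rfl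
  intro y hy
  split_ifs with hya
  · rw [hya, hata]
  · exact hzero y hy hya

/-- Local constancy of the number of zeros minus poles: if `f` has finite order at `a`, the orders
of `f - c` at the points of a suitable small neighbourhood add up to the order of `f` at `a`, for
all small `c`. -/
theorem exists_isOpen_finsum_order_sub_const {f : ℂ → ℂ} {a : ℂ} (hf : MeromorphicAt f a)
    (hord : meromorphicOrderAt f a ≠ ⊤) {V : Set ℂ} (hV : V ∈ 𝓝 a) :
    ∃ U : Set ℂ, IsOpen U ∧ a ∈ U ∧ U ⊆ V ∧ ∀ᶠ c in 𝓝 (0 : ℂ),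
      {y ∈ U | (meromorphicOrderAt (fun z => f z - c) y).untop₀ ≠ 0}.Finite ∧
      ∑ᶠ y ∈ U, (meromorphicOrderAt (fun z => f z - c) y).untop₀ =
        (meromorphicOrderAt f a).untop₀ := by
  obtain ⟨u, hu, hua, hfu⟩ := (meromorphicOrderAt_ne_top_iff hf).1 hord
  set m := (meromorphicOrderAt f a).untop₀ with hm
  rcases lt_or_ge 0 m with hpos | hneg
  · obtain ⟨n, hn⟩ := Int.eq_ofNat_of_zero_le hpos.le
    have hn0 : n ≠ 0 := by rintro rfl; simp [hn] at hpos
    obtain ⟨H, ha, hHa, hder, hpow⟩ := exists_openPartialHomeomorph_pow_eq hn0 hu hua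
    have hfH : ∀ᶠ z in 𝓝 a, z ≠ a → f z = H z ^ n := by
      filter_upwards [eventually_nhdsWithin_iff.1 hfu, hpow] with z h1 h2 hz
      rw [h1 hz, h2, hn]; simp
    have hall := (hder.and hfH).and (Filter.eventually_mem_set.2 hV)
    obtain ⟨O, hO, hOo, haO⟩ := eventually_nhds_iff.1 hall
    let K := H.restrOpen O hOo
    have hKs : K.source = H.source ∩ O := H.restrOpen_source O hOo
    have haK : a ∈ K.source := by rw [hKs]; exact ⟨ha, haO⟩
    have h0 : (0 : ℂ) ∈ K.target := by
      have := K.map_source haK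
      rwa [show K a = 0 from hHa] at this
    obtain ⟨ρ, hρ, hball⟩ := Metric.isOpen_iff.1 K.open_target 0 h0
    -- The neighbourhood is the full preimage of a disc under the coordinate K, so the count for wⁿ
    -- - c on the disc transfers to f - c = Kⁿ - c.
    have hbij : Set.BijOn K (K.source ∩ K ⁻¹' Metric.ball 0 ρ) (Metric.ball 0 ρ) := by
      refine ⟨fun z hz => hz.2, K.injOn.mono Set.inter_subset_left, fun w hw => ?_⟩
      exact ⟨K.symm w, ⟨K.map_target (hball hw), by
        simpa [Set.mem_preimage, K.right_inv (hball hw)] using hw⟩, K.right_inv (hball hw)⟩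
    refine ⟨K.source ∩ K ⁻¹' Metric.ball 0 ρ, K.isOpen_inter_preimage Metric.isOpen_ball,
      ⟨haK, by simp [show K a = 0 from hHa, hρ]⟩, fun z hz => ?_, ?_⟩
    · have := hz.1; rw [hKs] at this; exact (hO z this.2).2
    · have hsmall : ∀ᶠ c in 𝓝 (0 : ℂ), ‖c‖ < ρ ^ n := by
        have := Metric.ball_mem_nhds (0 : ℂ) (pow_pos hρ n)
        filter_upwards [this] with c hc
        simpa using hc
      filter_upwards [hsmall] with c hc
      obtain ⟨hfin, hsum⟩ := finite_and_finsum_order_pow_sub_const hn0 hρ hc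
      have key : ∀ y ∈ K.source ∩ K ⁻¹' Metric.ball 0 ρ,
          (meromorphicOrderAt (fun z => f z - c) y).untop₀ =
            (meromorphicOrderAt (fun w => w ^ n - c) (K y)).untop₀ := by
        intro y hy
        have hyO : y ∈ O := by have := hy.1; rw [hKs] at this; exact this.2
        obtain ⟨⟨⟨hK1, hK2⟩, -⟩, -⟩ := hO y hyO
        rw [show K y = H y from rfl, ← meromorphicOrderAt_comp_of_deriv_ne_zero hK1 hK2]
        congr 1
        refine meromorphicOrderAt_congr ?_
        have e1 : ∀ᶠ z in 𝓝[≠] y, z ∈ O := nhdsWithin_le_nhds (hOo.mem_nhds hyO)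
        have e2 := eventually_nhdsNE_ne a y
        filter_upwards [e1, e2] with z hz1 hz2
        simp [(hO z hz1).1.2 hz2]
      refine ⟨?_, ?_⟩
      · refine Set.Finite.of_finite_image (f := K) (hfin.subset ?_)
          (hbij.injOn.mono fun z hz => hz.1)
        rintro _ ⟨y, hy, rfl⟩
        have := hy.2
        rw [key y hy.1] at this
        exact this
      · rw [finsum_mem_eq_of_bijOn (g := fun w => (meromorphicOrderAt (fun w => w ^ n - c) w).untop₀)
          K hbij key, hsum, hn]
  · obtain ⟨U, hU, haU, hUV, hc⟩ := exists_isOpen_order_sub_const_of_nonpos hf hord hneg hV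
    refine ⟨U, hU, haU, hUV, hc.mono fun c hc => ?_⟩
    refine ⟨(Set.finite_singleton a).subset fun y hy => ?_, ?_⟩
    · by_contra hya
      exact hy.2 ((hc y hy.1).trans (if_neg hya))
    · rw [finsum_mem_inter_support_eq' _ U {a}, finsum_mem_singleton, hc a haU, if_pos rfl]
      intro y hy
      refine ⟨fun hyO => ?_, fun h => by rw [Set.mem_singleton_iff.1 h]; exact haU⟩
      by_contra hya
      exact hy ((hc y hyO).trans (if_neg hya))

end LocalDegree

/-! ### Meromorphic functions on a closed Riemann surface have divisors of degree zero. -/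

section MeromorphicOnSurface
open Filter Topology

variable {X : Type*} [TopologicalSpace X] [ChartedSpace ℂ X]

/-- The function `f` read in the preferred chart at `x`. -/
def inChart (f : X → ℂ) (x : X) : ℂ → ℂ := fun z => f ((chartAt ℂ x).symm z)

/-- The order of a function at a point of a Riemann surface. -/
def chartOrder (f : X → ℂ) (x : X) : WithTop ℤ :=
  meromorphicOrderAt (inChart f x) (chartAt ℂ x x)

/-- Meromorphy of a function at a point of a Riemann surface. -/
def ChartMeromorphicAt (f : X → ℂ) (x : X) : Prop :=
  MeromorphicAt (inChart f x) (chartAt ℂ x x)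

theorem tendsto_chartAt (x : X) : Tendsto (chartAt ℂ x) (𝓝 x) (𝓝 (chartAt ℂ x x)) :=
  (chartAt ℂ x).continuousAt (mem_chart_source ℂ x)

theorem tendsto_chartAt_symm (x : X) :
    Tendsto (chartAt ℂ x).symm (𝓝 (chartAt ℂ x x)) (𝓝 x) := by
  have := (chartAt ℂ x).symm.continuousAt (mem_chart_target ℂ x)
  rwa [ContinuousAt, (chartAt ℂ x).left_inv (mem_chart_source ℂ x)] at this

theorem inChart_eventuallyEq (f : X → ℂ) {x y : X} (hy : y ∈ (chartAt ℂ x).source) :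
    inChart f y =ᶠ[𝓝 (chartAt ℂ y y)]
      inChart f x ∘ (chartAt ℂ x ∘ (chartAt ℂ y).symm) := by
  filter_upwards [tendsto_chartAt_symm y ((chartAt ℂ x).open_source.mem_nhds hy)] with z hz
  have hz : (chartAt ℂ y).symm z ∈ (chartAt ℂ x).source := hz
  simp [inChart, (chartAt ℂ x).left_inv hz]

theorem eventually_eventually_nhdsNE {a : ℂ} {P : ℂ → Prop} (h : ∀ᶠ z in 𝓝[≠] a, P z) :
    ∀ᶠ y in 𝓝 a, ∀ᶠ z in 𝓝[≠] y, P z := by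
  obtain ⟨O, hO, hOo, haO⟩ := eventually_nhds_iff.1 (eventually_nhdsWithin_iff.1 h)
  filter_upwards [hOo.mem_nhds haO] with y hy
  filter_upwards [nhdsWithin_le_nhds (hOo.mem_nhds hy), eventually_nhdsNE_ne a y] with z h1 h2
  exact hO z h1 h2

section Transition

variable [IsManifold 𝓘(ℂ, ℂ) ω X]

theorem analyticAt_transition {x y : X} {z : ℂ} (hz : z ∈ (chartAt ℂ y).target)
    (hzx : (chartAt ℂ y).symm z ∈ (chartAt ℂ x).source) :
    AnalyticAt ℂ (chartAt ℂ x ∘ (chartAt ℂ y).symm) z := by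
  have h := contDiffWithinAt_ext_coord_change (I := 𝓘(ℂ, ℂ)) (n := ω) x y (y := z)
    (by simp [hz, hzx])
  simp only [extChartAt, modelWithCornersSelf_coe, Set.range_id, contDiffWithinAt_univ] at h
  exact h.analyticAt

/-- Chain rule: composing with the reverse transition map gives the identity near z. Together with
analyticity this makes the order independent of the chart. -/
theorem deriv_transition_ne_zero {x y : X} {z : ℂ} (hz : z ∈ (chartAt ℂ y).target)
    (hzx : (chartAt ℂ y).symm z ∈ (chartAt ℂ x).source) :
    deriv (chartAt ℂ x ∘ (chartAt ℂ y).symm) z ≠ 0 := by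
  have h1 := (analyticAt_transition hz hzx).differentiableAt
  have hw : (chartAt ℂ x) ((chartAt ℂ y).symm z) ∈ (chartAt ℂ x).target :=
    (chartAt ℂ x).map_source hzx
  have hwy : (chartAt ℂ x).symm ((chartAt ℂ x) ((chartAt ℂ y).symm z)) ∈ (chartAt ℂ y).source := by
    rw [(chartAt ℂ x).left_inv hzx]; exact (chartAt ℂ y).map_target hz
  have h2 := (analyticAt_transition hw hwy).differentiableAt
  have hcomp := HasDerivAt.comp z h2.hasDerivAt h1.hasDerivAt
  have hid : (chartAt ℂ y ∘ (chartAt ℂ x).symm) ∘ (chartAt ℂ x ∘ (chartAt ℂ y).symm) =ᶠ[𝓝 z] id := by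
    have hc := (chartAt ℂ y).symm.continuousAt hz
    filter_upwards [(chartAt ℂ y).open_target.mem_nhds hz,
      hc.preimage_mem_nhds ((chartAt ℂ x).open_source.mem_nhds hzx)] with w hw1 hw2
    simp only [Function.comp_apply, id]
    rw [(chartAt ℂ x).left_inv hw2, (chartAt ℂ y).right_inv hw1]
  have := (hcomp.congr_of_eventuallyEq hid.symm).unique (hasDerivAt_id z)
  intro h0
  rw [h0, mul_zero] at this
  exact zero_ne_one this

/-- The order can be computed in any chart. -/
theorem chartOrder_eq (f : X → ℂ) {x y : X} (hy : y ∈ (chartAt ℂ x).source) :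
    chartOrder f y = meromorphicOrderAt (inChart f x) (chartAt ℂ x y) := by
  have hsrc : (chartAt ℂ y).symm (chartAt ℂ y y) = y := (chartAt ℂ y).left_inv (mem_chart_source ℂ y)
  have hyx : (chartAt ℂ y).symm (chartAt ℂ y y) ∈ (chartAt ℂ x).source := by rwa [hsrc]
  rw [chartOrder,
    meromorphicOrderAt_congr ((inChart_eventuallyEq f hy).filter_mono nhdsWithin_le_nhds),
    meromorphicOrderAt_comp_of_deriv_ne_zero (analyticAt_transition (mem_chart_target ℂ y) hyx)
      (deriv_transition_ne_zero (mem_chart_target ℂ y) hyx)]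
  simp only [Function.comp_apply, hsrc]

/-- The identity theorem: a meromorphic function on a connected surface which vanishes identically
near a point vanishes identically near every point. -/
theorem chartOrder_eq_top_of_exists [ConnectedSpace X] {f : X → ℂ}
    (hf : ∀ x, ChartMeromorphicAt f x) {x₀ : X} (h₀ : chartOrder f x₀ = ⊤) (x : X) :
    chartOrder f x = ⊤ := by
  have hnhds : ∀ (x : X) (P : WithTop ℤ → Prop),
      (∀ᶠ z in 𝓝 (chartAt ℂ x x), P (meromorphicOrderAt (inChart f x) z)) →
        ∀ᶠ y in 𝓝 x, P (chartOrder f y) := by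
    intro x P h
    filter_upwards [(tendsto_chartAt x).eventually h,
      (chartAt ℂ x).open_source.mem_nhds (mem_chart_source ℂ x)] with y h1 h2
    rwa [chartOrder_eq f h2]
  have hclopen : IsClopen {x | chartOrder f x = ⊤} := by
    refine ⟨⟨isOpen_iff_mem_nhds.2 fun x hx => ?_⟩, isOpen_iff_mem_nhds.2 fun x hx => ?_⟩
    -- A germ of finite order is nonzero on a punctured neighbourhood, hence cannot vanish
    -- identically near any nearby point.
    · refine hnhds x (· ≠ ⊤) ?_
      have h1 := (meromorphicOrderAt_ne_top_iff_eventually_ne_zero (hf x)).1 hx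
      filter_upwards [eventually_eventually_nhdsNE h1] with y hy htop
      obtain ⟨z, hz1, hz2⟩ := (hy.and (meromorphicOrderAt_eq_top_iff.1 htop)).exists
      exact hz1 hz2
    · refine hnhds x (· = ⊤) ?_
      filter_upwards [eventually_eventually_nhdsNE (meromorphicOrderAt_eq_top_iff.1 hx)] with y hy
      exact meromorphicOrderAt_eq_top_iff.2 hy
  rcases isClopen_iff.1 hclopen with h | h
  · exact absurd (show x₀ ∈ {x | chartOrder f x = ⊤} from h₀) (by simp [h])
  · exact h.ge (Set.mem_univ x)

end Transition

theorem ChartMeromorphicAt.sub_const {f : X → ℂ} {x : X} (hf : ChartMeromorphicAt f x) (c : ℂ) :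
    ChartMeromorphicAt (fun y => f y - c) x :=
  MeromorphicAt.sub hf (MeromorphicAt.const c _)

variable [IsManifold 𝓘(ℂ, ℂ) ω X]

theorem exists_isOpen_finsum_chartOrder_sub_const {f : X → ℂ} {x : X}
    (hf : ChartMeromorphicAt f x) (hord : chartOrder f x ≠ ⊤) {V : Set X} (hV : V ∈ 𝓝 x) :
    ∃ U : Set X, IsOpen U ∧ x ∈ U ∧ U ⊆ V ∧ ∀ᶠ c in 𝓝 (0 : ℂ),
      {y ∈ U | (chartOrder (fun z => f z - c) y).untop₀ ≠ 0}.Finite ∧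
      ∑ᶠ y ∈ U, (chartOrder (fun z => f z - c) y).untop₀ = (chartOrder f x).untop₀ := by
  obtain ⟨U, hU, hxU, hUV, hc⟩ := exists_isOpen_finsum_order_sub_const hf hord
    (V := (chartAt ℂ x).target ∩ (chartAt ℂ x).symm ⁻¹' V)
    (inter_mem ((chartAt ℂ x).open_target.mem_nhds (mem_chart_target ℂ x))
      (tendsto_chartAt_symm x hV))
  have hbij : Set.BijOn (chartAt ℂ x) ((chartAt ℂ x).source ∩ chartAt ℂ x ⁻¹' U) U := by
    refine ⟨fun z hz => hz.2, (chartAt ℂ x).injOn.mono Set.inter_subset_left, fun w hw => ?_⟩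
    have hwt := (hUV hw).1
    exact ⟨(chartAt ℂ x).symm w, ⟨(chartAt ℂ x).map_target hwt, by
      rwa [Set.mem_preimage, (chartAt ℂ x).right_inv hwt]⟩, (chartAt ℂ x).right_inv hwt⟩
  refine ⟨(chartAt ℂ x).source ∩ chartAt ℂ x ⁻¹' U, (chartAt ℂ x).isOpen_inter_preimage hU,
    ⟨mem_chart_source ℂ x, hxU⟩, fun y hy => ?_, hc.mono fun c hc => ?_⟩
  · have := (hUV hy.2).2
    rwa [Set.mem_preimage, (chartAt ℂ x).left_inv hy.1] at this
  · have key : ∀ y ∈ (chartAt ℂ x).source ∩ chartAt ℂ x ⁻¹' U,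
        (chartOrder (fun z => f z - c) y).untop₀ =
          (meromorphicOrderAt (fun z => inChart f x z - c) (chartAt ℂ x y)).untop₀ := fun y hy => by
      rw [chartOrder_eq _ hy.1]; rfl
    refine ⟨?_, ?_⟩
    · refine Set.Finite.of_finite_image (f := chartAt ℂ x) (hc.1.subset ?_)
        (hbij.injOn.mono fun z hz => hz.1)
      rintro _ ⟨y, hy, rfl⟩
      have := hy.2
      rw [key y hy.1] at this
      exact ⟨hy.1.2, this⟩
    · rw [finsum_mem_eq_of_bijOn
        (g := fun w => (meromorphicOrderAt (fun z => inChart f x z - c) w).untop₀) _ hbij key, hc.2]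
      rfl

/-- Stated jointly in the constant and the point, so that compactness yields one bound on c valid
along a whole compact set. -/
theorem eventually_chartOrder_sub_const_eq_zero {f : X → ℂ} {x : X}
    (hf : ChartMeromorphicAt f x) (hord : chartOrder f x = 0) :
    ∀ᶠ p : ℂ × X in 𝓝 (0, x), (chartOrder (fun z => f z - p.1) p.2).untop₀ = 0 := by
  have hord' : meromorphicOrderAt (inChart f x) (chartAt ℂ x x) = 0 := hord
  obtain ⟨U, hU, hxU, -, hc⟩ := exists_isOpen_order_sub_const_of_nonpos hf
    (by rw [hord']; exact WithTop.zero_ne_top) (by rw [hord']; rfl) univ_mem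
  have h2 : ∀ᶠ y in 𝓝 x, y ∈ (chartAt ℂ x).source ∧ chartAt ℂ x y ∈ U :=
    Filter.Eventually.and ((chartAt ℂ x).open_source.mem_nhds (mem_chart_source ℂ x))
      (tendsto_chartAt x (hU.mem_nhds hxU))
  rw [nhds_prod_eq]
  filter_upwards [hc.prod_mk h2] with p hp
  rw [chartOrder_eq _ hp.2.1]
  refine (hp.1 _ hp.2.2).trans ?_
  rw [hord']; simp

variable [CompactSpace X]

theorem finite_setOf_chartOrder_ne_zero {f : X → ℂ} (hf : ∀ x, ChartMeromorphicAt f x)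
    (hord : ∀ x, chartOrder f x ≠ ⊤) : {x | (chartOrder f x).untop₀ ≠ 0}.Finite := by
  choose U hU hxU _ hc using fun x => exists_isOpen_finsum_chartOrder_sub_const (hf x) (hord x)
    univ_mem
  obtain ⟨t, ht⟩ := CompactSpace.elim_nhds_subcover U fun x => (hU x).mem_nhds (hxU x)
  -- The local finiteness statement is used at c = 0, on each member of a finite cover.
  refine (t.finite_toSet.biUnion fun x _ => ((hc x).self_of_nhds).1).subset fun y hy => ?_
  have : y ∈ ⋃ x ∈ t, U x := by rw [ht]; trivial
  obtain ⟨x, hx, hyx⟩ := Set.mem_iUnion₂.1 this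
  refine Set.mem_biUnion hx ⟨hyx, ?_⟩
  simpa using hy

/-- Around the finitely many zeros and poles, disjoint neighbourhoods preserve their local total
order for small c; on the compact complement f - c acquires neither zeros nor poles. -/
theorem eventually_finsum_chartOrder_sub_const [T2Space X] {f : X → ℂ}
    (hf : ∀ x, ChartMeromorphicAt f x) (hord : ∀ x, chartOrder f x ≠ ⊤) :
    ∀ᶠ c in 𝓝 (0 : ℂ), ∑ᶠ x, (chartOrder (fun z => f z - c) x).untop₀ =
      ∑ᶠ x, (chartOrder f x).untop₀ := by
  have hZ := finite_setOf_chartOrder_ne_zero hf hord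
  set Z := {x | (chartOrder f x).untop₀ ≠ 0} with hZdef
  obtain ⟨V, hV, hdisj⟩ := hZ.t2_separation
  choose U hU hxU hUV hc using fun x => exists_isOpen_finsum_chartOrder_sub_const (hf x) (hord x)
    ((hV x).2.mem_nhds (hV x).1)
  have hK : IsCompact (⋃ x ∈ Z, U x)ᶜ :=
    (isOpen_biUnion fun x _ => hU x).isClosed_compl.isCompact
  have hKc := hK.eventually_forall_of_forall_eventually (x₀ := (0 : ℂ))
    (P := fun c y => (chartOrder (fun z => f z - c) y).untop₀ = 0) fun y hy => by
      refine eventually_chartOrder_sub_const_eq_zero (hf y) ?_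
      have hyZ : y ∉ Z := fun h => hy (Set.mem_biUnion h (hxU y))
      have : (chartOrder f y).untop₀ = 0 := not_not.1 hyZ
      rw [← WithTop.coe_untop₀_of_ne_top (hord y), this]; rfl
  have hZc : ∀ᶠ c in 𝓝 (0 : ℂ), ∀ x ∈ Z,
      {y ∈ U x | (chartOrder (fun z => f z - c) y).untop₀ ≠ 0}.Finite ∧
      ∑ᶠ y ∈ U x, (chartOrder (fun z => f z - c) y).untop₀ = (chartOrder f x).untop₀ :=
    (eventually_all_finite hZ).2 fun x _ => hc x
  filter_upwards [hKc, hZc] with c h1 h2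
  set D : X → ℤ := fun y => (chartOrder (fun z => f z - c) y).untop₀ with hD
  -- Cutting down to the support makes each piece finite, as summing over a disjoint union requires.
  have e1 : ∑ᶠ x, D x = ∑ᶠ y ∈ ⋃ x ∈ Z, (U x ∩ Function.support D), D y := by
    rw [← finsum_mem_univ]
    refine finsum_mem_inter_support_eq' _ _ _ fun y hy => ⟨fun _ => ?_, fun _ => trivial⟩
    have : y ∈ ⋃ x ∈ Z, U x := by
      by_contra h
      exact hy (h1 y h)
    obtain ⟨x, hx, hyx⟩ := Set.mem_iUnion₂.1 this
    exact Set.mem_biUnion hx ⟨hyx, hy⟩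
  rw [e1, finsum_mem_biUnion (fun x hx y hy hxy => ?_) hZ (fun x hx => ?_)]
  · have e2 : ∑ᶠ x, (chartOrder f x).untop₀ = ∑ᶠ x ∈ Z, (chartOrder f x).untop₀ := by
      rw [← finsum_mem_univ]
      exact finsum_mem_inter_support_eq' _ _ _ fun y hy => ⟨fun _ => hy, fun _ => trivial⟩
    rw [e2]
    refine finsum_mem_congr rfl fun x hx => ?_
    rw [finsum_mem_inter_support]
    exact (h2 x hx).2
  · exact (hdisj hx hy hxy).mono (Set.inter_subset_left.trans (hUV x))
      (Set.inter_subset_left.trans (hUV y))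
  · exact (h2 x hx).1

/-- The degree of the divisor of `f - c` does not depend on `c`. -/
theorem finsum_chartOrder_sub_const_eq [T2Space X] {f : X → ℂ}
    (hf : ∀ x, ChartMeromorphicAt f x) (hord : ∀ c x, chartOrder (fun z => f z - c) x ≠ ⊤)
    (c c' : ℂ) : ∑ᶠ x, (chartOrder (fun z => f z - c) x).untop₀ =
      ∑ᶠ x, (chartOrder (fun z => f z - c') x).untop₀ := by
  have hloc : IsLocallyConstant fun c => ∑ᶠ x, (chartOrder (fun z => f z - c) x).untop₀ := by
    rw [IsLocallyConstant.iff_eventually_eq]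
    intro c
    have h := eventually_finsum_chartOrder_sub_const (fun x => (hf x).sub_const c) (hord c)
    have ht : Tendsto (fun c' => c' - c) (𝓝 c) (𝓝 0) := by
      have : Tendsto (fun c' => c' - c) (𝓝 c) (𝓝 (c - c)) := tendsto_id.sub_const c
      rwa [sub_self] at this
    filter_upwards [ht.eventually h] with c' hc'
    simpa only [sub_sub, add_sub_cancel] using hc'
  exact hloc.apply_eq_of_isPreconnected isPreconnected_univ trivial trivial

/-- The degree of the divisor of a meromorphic function on a closed Riemann surface is zero. -/
theorem finsum_chartOrder_eq_zero [T2Space X] [ConnectedSpace X] {f : X → ℂ}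
    (hf : ∀ x, ChartMeromorphicAt f x) (hord : ∀ x, chartOrder f x ≠ ⊤) :
    ∑ᶠ x, (chartOrder f x).untop₀ = 0 := by
  have hne : ∀ x, ∀ᶠ z in 𝓝[≠] (chartAt ℂ x x), inChart f x z ≠ 0 := fun x =>
    (meromorphicOrderAt_ne_top_iff_eventually_ne_zero (hf x)).1 (hord x)
  -- If f - c vanishes identically somewhere, the identity theorem makes f a nonzero constant near
  -- every point, up to that point, and all orders are 0. Otherwise the total order of f - c is
  -- defined for all c.
  by_cases hconst : ∃ c x, chartOrder (fun z => f z - c) x = ⊤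
  · obtain ⟨c, x₀, hx₀⟩ := hconst
    have hc : ∀ x, ∀ᶠ z in 𝓝[≠] (chartAt ℂ x x), inChart f x z - c = 0 := fun x =>
      meromorphicOrderAt_eq_top_iff.1
        (chartOrder_eq_top_of_exists (fun x => (hf x).sub_const c) hx₀ x)
    have hc0 : c ≠ 0 := by
      obtain ⟨z, h1, h2⟩ := ((hne x₀).and (hc x₀)).exists
      rw [sub_eq_zero] at h2
      rwa [← h2]
    refine finsum_eq_zero_of_forall_eq_zero fun x => ?_
    have : inChart f x =ᶠ[𝓝[≠] (chartAt ℂ x x)] fun _ => c := by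
      filter_upwards [hc x] with z hz using sub_eq_zero.1 hz
    classical
    rw [chartOrder, meromorphicOrderAt_congr this, meromorphicOrderAt_const, if_neg hc0]
    rfl
  · push Not at hconst
    set g : X → ℂ := fun x => (f x)⁻¹ with hg
    have hgm : ∀ x, ChartMeromorphicAt g x := fun x => MeromorphicAt.inv (hf x)
    -- relation between the orders of `f - 1 / t` and `1 / f - t`
    have hrel : ∀ t : ℂ, t ≠ 0 → ∀ x, chartOrder (fun z => f z - t⁻¹) x =
        chartOrder (fun z => g z - t) x + chartOrder f x := by
      intro t ht x
      rw [chartOrder, chartOrder, chartOrder,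
        ← meromorphicOrderAt_mul ((hgm x).sub_const t) (hf x)]
      -- With g = 1/f this is (g - t) f = -t (f - 1/t).
      have h1 : (inChart (fun z => g z - t) x * inChart f x) =ᶠ[𝓝[≠] (chartAt ℂ x x)]
          ((fun _ => -t) * inChart (fun z => f z - t⁻¹) x) := by
        filter_upwards [hne x] with z hz
        simp only [inChart, Pi.mul_apply, hg] at hz ⊢
        field_simp
        ring
      rw [meromorphicOrderAt_congr h1, meromorphicOrderAt_mul_of_ne_zero analyticAt_const
        (neg_ne_zero.2 ht)]
    have hinv : ∀ x, chartOrder g x = - chartOrder f x := fun x =>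
      meromorphicOrderAt_inv (f := inChart f x)
    have hgt : ∀ t x, chartOrder (fun z => g z - t) x ≠ ⊤ := by
      intro t x htop
      rcases eq_or_ne t 0 with rfl | ht
      · simp only [sub_zero] at htop
        rw [hinv, ← WithTop.coe_untop₀_of_ne_top (hord x)] at htop
        exact WithTop.coe_ne_top htop
      · refine hconst t⁻¹ x ?_
        rw [hrel t ht, htop, WithTop.top_add]
    have hsupf := finite_setOf_chartOrder_ne_zero hf hord
    have hsupg := finite_setOf_chartOrder_ne_zero (fun x => (hgm x).sub_const 1) (hgt 1)
    have e1 : ∑ᶠ x, (chartOrder f x).untop₀ =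
        ∑ᶠ x, (chartOrder (fun z => f z - 1) x).untop₀ := by
      simpa only [sub_zero] using finsum_chartOrder_sub_const_eq hf hconst 0 1
    have e2 : ∑ᶠ x, (chartOrder g x).untop₀ =
        ∑ᶠ x, (chartOrder (fun z => g z - 1) x).untop₀ := by
      simpa only [sub_zero] using finsum_chartOrder_sub_const_eq hgm hgt 0 1
    have e3 : ∑ᶠ x, (chartOrder (fun z => f z - 1) x).untop₀ =
        ∑ᶠ x, (chartOrder (fun z => g z - 1) x).untop₀ + ∑ᶠ x, (chartOrder f x).untop₀ := by
      rw [← finsum_add_distrib hsupg hsupf]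
      refine finsum_congr fun x => ?_
      have := hrel 1 one_ne_zero x
      rw [inv_one] at this
      rw [this, WithTop.untop₀_add (hgt 1 x) (hord x)]
    have e4 : ∑ᶠ x, (chartOrder g x).untop₀ = - ∑ᶠ x, (chartOrder f x).untop₀ := by
      rw [← finsum_neg_distrib]
      refine finsum_congr fun x => ?_
      rw [hinv, WithTop.untop₀_neg]
    -- `e1` and `e3` make the total order of g - 1 vanish; by `e2` that of g vanishes, and by `e4`
    -- that of f.
    omega

end MeromorphicOnSurface

/-! ### Subbundles with trivial determinant have degree zero. -/

section Degree
open Filter Topology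

variable {X : Type*} [TopologicalSpace X] [ChartedSpace ℂ X]

theorem analyticAt_inChart {h : X → ℂ} {x : X} (hh : ContMDiffAt 𝓘(ℂ, ℂ) 𝓘(ℂ, ℂ) ω h x) :
    AnalyticAt ℂ (inChart h x) (chartAt ℂ x x) := by
  have := (contMDiffAt_iff.1 hh).2
  simp only [extChartAt, modelWithCornersSelf_coe, Set.range_id, contDiffWithinAt_univ] at this
  exact this.analyticAt

variable {F : Type*} [NormedAddCommGroup F] [NormedSpace ℂ F]
  {W : X → Type*} [∀ x, AddCommGroup (W x)] [∀ x, Module ℂ (W x)]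
  [∀ x, TopologicalSpace (W x)] [TopologicalSpace (TotalSpace F W)] [FiberBundle F W]

namespace HolSubbundle

/-- Recasts the frame as sections with values in the fibres of S; off U they are set to 0, since
nothing is asked there. -/
theorem exists_isFrameOn (S : HolSubbundle F W) (x₀ : X) :
    ∃ U : Set X, x₀ ∈ U ∧ ∃ s : Fin S.rank → ∀ x, S.fiber x, S.IsFrameOn U s := by
  classical
  obtain ⟨U, hU, hx, s, hs, hs'⟩ := S.exists_frame x₀
  have hmem : ∀ x ∈ U, ∀ i, s i x ∈ S.fiber x := fun x hxU i => by
    rw [← (hs' x hxU).2]; exact Submodule.subset_span ⟨i, rfl⟩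
  refine ⟨U, hx, fun i x => if h : x ∈ U then ⟨s i x, hmem x h i⟩ else 0, hU, fun i => ?_,
    fun x hxU => ?_⟩
  · refine (hs i).congr fun x hxU => ?_
    simp [hxU]
  · refine LinearIndependent.of_comp (S.fiber x).subtype ?_
    convert (hs' x hxU).1 using 1
    ext i
    simp [hxU]

theorem finrank_fiber (S : HolSubbundle F W) (x : X) : Module.finrank ℂ (S.fiber x) = S.rank := by
  obtain ⟨U, hU, hx, s, hs, hs'⟩ := S.exists_frame x
  rw [← (hs' x hx).2, finrank_span_eq_card (hs' x hx).1, Fintype.card_fin]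

theorem finite_fiber (S : HolSubbundle F W) (x : X) : Module.Finite ℂ (S.fiber x) := by
  obtain ⟨U, hU, hx, s, hs, hs'⟩ := S.exists_frame x
  rw [← (hs' x hx).2]
  exact FiniteDimensional.span_of_finite ℂ (Set.finite_range _)

/-- A frame is a basis of each fibre. -/
def IsFrameOn.basis {S : HolSubbundle F W} {U : Set X} {s : Fin S.rank → ∀ x, S.fiber x}
    (hs : S.IsFrameOn U s) {x : X} (hx : x ∈ U) : Module.Basis (Fin S.rank) ℂ (S.fiber x) :=
  haveI := S.finite_fiber x
  basisOfLinearIndependentOfCardEqFinrank' (fun i => s i x) (hs.2.2 x hx)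
    (by rw [Fintype.card_fin, S.finrank_fiber])

theorem IsFrameOn.coe_basis {S : HolSubbundle F W} {U : Set X} {s : Fin S.rank → ∀ x, S.fiber x}
    (hs : S.IsFrameOn U s) {x : X} (hx : x ∈ U) : ⇑(hs.basis hx) = fun i => s i x := by
  simp [IsFrameOn.basis]

variable [IsManifold 𝓘(ℂ, ℂ) ω X] [CompactSpace X] [T2Space X] [ConnectedSpace X]

/-- If `(det S)^*` has a holomorphic section without zeros, then `S` has degree zero. -/
theorem degree_eq_zero (S : HolSubbundle F W)
    (θ : ∀ x, (S.fiber x) [⋀^Fin S.rank]→ₗ[ℂ] ℂ) (hθ : ∀ x, θ x ≠ 0)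
    (hol : ∀ (U : Set X) (s : Fin S.rank → ∀ x, S.fiber x), S.IsFrameOn U s →
      ContMDiffOn 𝓘(ℂ, ℂ) 𝓘(ℂ, ℂ) ω (fun x => θ x fun i => s i x) U) : S.degree = 0 := by
  rw [degree]
  split_ifs with h
  -- If no meromorphic section exists, the degree is 0 by its default value.
  swap
  · rfl
  obtain ⟨η, D, hD, hd⟩ := h.choose_spec
  rw [hd, neg_eq_zero]
  -- The forms of top degree on a fibre are a line spanned by θ, so η = f θ. As θ is holomorphic
  -- without zeros, f is meromorphic with the same divisor as η.
  have hf : ∀ x, ∃ c : ℂ, η x = c • θ x := fun x => by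
    obtain ⟨U, hx, s, hs⟩ := S.exists_isFrameOn x
    let b := hs.basis hx
    have hb : θ x b ≠ 0 := (AlternatingMap.map_basis_ne_zero_iff b (θ x)).2 (hθ x)
    refine ⟨η x b / θ x b, ?_⟩
    have h2 : θ x = θ x b • b.det := (θ x).eq_smul_basis_det b
    have h1 : η x = η x b • b.det := (η x).eq_smul_basis_det b
    have h3 : (η x b / θ x b) • θ x = (η x b / θ x b) • (θ x b • b.det) := congrArg _ h2
    rw [h3, smul_smul, div_mul_cancel₀ _ hb]
    exact h1
  choose f hf using hf
  have key : ∀ x, ChartMeromorphicAt f x ∧ chartOrder f x = (D x : WithTop ℤ) := fun x => by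
    obtain ⟨U, hx, s, hs⟩ := S.exists_isFrameOn x
    obtain ⟨h1, h2⟩ := hD U s hs x hx
    let g : X → ℂ := fun x => θ x fun i => s i x
    have hg : AnalyticAt ℂ (inChart g x) (chartAt ℂ x x) :=
      analyticAt_inChart ((hol U s hs).contMDiffAt (hs.1.mem_nhds hx))
    have hg0 : ∀ y ∈ U, g y ≠ 0 := fun y hy => by
      have := (AlternatingMap.map_basis_ne_zero_iff (hs.basis hy) (θ y)).2 (hθ y)
      rwa [hs.coe_basis hy] at this
    have hgx : inChart g x (chartAt ℂ x x) ≠ 0 := by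
      rw [inChart, (chartAt ℂ x).left_inv (mem_chart_source ℂ x)]
      exact hg0 x hx
    have hfe : inChart f x =ᶠ[𝓝 (chartAt ℂ x x)] (inChart g x)⁻¹ *
        fun z => η ((chartAt ℂ x).symm z) fun i => s i ((chartAt ℂ x).symm z) := by
      filter_upwards [tendsto_chartAt_symm x (hs.1.mem_nhds hx)] with z hz
      have := hg0 _ hz
      simp only [inChart, Pi.mul_apply, Pi.inv_apply, hf, AlternatingMap.smul_apply, smul_eq_mul]
      rw [mul_comm, mul_assoc, mul_inv_cancel₀ this, mul_one]
    refine ⟨?_, ?_⟩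
    · exact (hg.inv hgx).meromorphicAt.mul h1 |>.congr (hfe.symm.filter_mono nhdsWithin_le_nhds)
    · rw [chartOrder, meromorphicOrderAt_congr (hfe.filter_mono nhdsWithin_le_nhds),
        meromorphicOrderAt_mul_of_ne_zero (hg.inv hgx) (inv_ne_zero hgx), h2]
  have := finsum_chartOrder_eq_zero (fun x => (key x).1)
    (fun x => by rw [(key x).2]; exact WithTop.coe_ne_top)
  rw [← this]
  refine finsum_congr fun x => ?_
  rw [(key x).2]; rfl

/-- The zero subbundle has degree zero. -/
theorem degree_eq_zero_of_fiber_eq_bot {S : HolSubbundle F W} (hS : S.fiber = ⊥) :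
    S.degree = 0 := by
  obtain ⟨x₀⟩ : Nonempty X := inferInstance
  have hr : S.rank = 0 := by
    rw [← S.finrank_fiber x₀, hS]
    exact finrank_bot ℂ (W x₀)
  have : IsEmpty (Fin S.rank) := by rw [hr]; infer_instance
  refine S.degree_eq_zero (fun x => AlternatingMap.constOfIsEmpty ℂ (S.fiber x) (Fin S.rank) 1)
    (fun x h => ?_) fun U s hs => ?_
  · have := DFunLike.congr_fun h 0
    simp at this
  · simp only [AlternatingMap.constOfIsEmpty_apply]
    exact contMDiffOn_const

/-- A subbundle whose fibres are those of a bundle with trivial determinant has degree zero. -/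
theorem degree_eq_zero_of_fiber_eq_top {S : HolSubbundle F W} (hS : S.fiber = ⊤)
    (d : DetTrivialization F W) (hW : ∀ x, Module.finrank ℂ (W x) = Module.finrank ℂ F) :
    S.degree = 0 := by
  obtain ⟨x₀⟩ : Nonempty X := inferInstance
  have hfib : ∀ x, S.fiber x = ⊤ := fun x => by rw [hS]; rfl
  have hr : Module.finrank ℂ F = S.rank := by
    rw [← S.finrank_fiber x₀, hfib, finrank_top, hW]
  refine S.degree_eq_zero (fun x => ((d.form x).domDomCongr (finCongr hr)).compLinearMap
    (S.fiber x).subtype) (fun x h => ?_) fun U s hs => ?_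
  · refine d.form_ne_zero x ?_
    ext v
    have := DFunLike.congr_fun h
      fun i => (⟨v ((finCongr hr).symm i), by rw [hfib]; trivial⟩ : S.fiber x)
    simpa [Function.comp_def] using this
  · have := d.holomorphic U hs.1 (fun i x => (s (finCongr hr i) x : W x)) fun i => hs.2.1 _
    exact this

end HolSubbundle
end Degree

/-! ### Holomorphic sections: coefficients, projections, images of constant rank. -/

section Sections
open Filter Topology

variable {X : Type*} [TopologicalSpace X]
  {F : Type*} [NormedAddCommGroup F] [NormedSpace ℂ F]
  {W : X → Type*} [∀ x, TopologicalSpace (W x)]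
  [TopologicalSpace (TotalSpace F W)] [FiberBundle F W]

section

variable [ChartedSpace ℂ X]

theorem HolomorphicSectionOn.mono {σ : ∀ x, W x} {U V : Set X} (h : HolomorphicSectionOn F σ U)
    (hVU : V ⊆ U) : HolomorphicSectionOn F σ V :=
  ContMDiffOn.mono h hVU

theorem HolomorphicSectionOn.congr {σ τ : ∀ x, W x} {U : Set X} (h : HolomorphicSectionOn F σ U)
    (hστ : ∀ x ∈ U, τ x = σ x) : HolomorphicSectionOn F τ U :=
  ContMDiffOn.congr h fun x hx => by rw [hστ x hx]

theorem holomorphicSectionOn_of_locally {σ : ∀ x, W x} {U : Set X}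
    (h : ∀ x ∈ U, ∃ V, IsOpen V ∧ x ∈ V ∧ HolomorphicSectionOn F σ (U ∩ V)) :
    HolomorphicSectionOn F σ U :=
  contMDiffOn_of_locally_contMDiffOn h

end

variable [∀ x, AddCommGroup (W x)] [∀ x, Module ℂ (W x)] [VectorBundle ℂ F W]

variable (F W) in
theorem finrank_fiber_eq (x : X) : Module.finrank ℂ (W x) = Module.finrank ℂ F :=
  ((trivializationAt F W x).linearEquivAt ℂ x
    (FiberBundle.mem_baseSet_trivializationAt' x)).finrank_eq

variable (F W) in
theorem finiteDimensional_fiber [FiniteDimensional ℂ F] (x : X) : FiniteDimensional ℂ (W x) :=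
  Module.Finite.equiv ((trivializationAt F W x).linearEquivAt ℂ x
    (FiberBundle.mem_baseSet_trivializationAt' x)).symm

variable [ChartedSpace ℂ X]

theorem holomorphicSectionOn_zero (U : Set X) :
    HolomorphicSectionOn F (fun x => (0 : W x)) U :=
  (contMDiff_zeroSection ℂ W).contMDiffOn

/-- Linear independence of continuous sections is an open condition. -/
theorem eventually_linearIndependent [FiniteDimensional ℂ F] {m : ℕ} {σ : Fin m → ∀ x, W x}
    {U : Set X} (hU : IsOpen U) (hσ : ∀ i, HolomorphicSectionOn F (σ i) U) {x₀ : X} (hx₀ : x₀ ∈ U)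
    (hli : LinearIndependent ℂ fun i => σ i x₀) :
    ∀ᶠ x in 𝓝 x₀, LinearIndependent ℂ fun i => σ i x := by
  let e := trivializationAt F W x₀
  have hx₀e : x₀ ∈ e.baseSet := FiberBundle.mem_baseSet_trivializationAt' x₀
  have hiff : ∀ x ∈ e.baseSet, (LinearIndependent ℂ fun i => σ i x) ↔
      LinearIndependent ℂ fun i => (e ⟨x, σ i x⟩).2 := fun x hx => by
    have := LinearMap.linearIndependent_iff (v := fun i => σ i x)
      (e.linearEquivAt ℂ x hx).toLinearMap (LinearEquiv.ker _)
    rw [← this]; rfl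
  have hcont : ContinuousAt (fun x => fun i => (e ⟨x, σ i x⟩).2) x₀ := by
    refine continuousAt_pi.2 fun i => ?_
    have h1 : ContinuousAt (fun x => TotalSpace.mk' F x (σ i x)) x₀ :=
      ((hσ i).continuousOn.continuousAt (hU.mem_nhds hx₀))
    have h2 : ContinuousAt e (TotalSpace.mk' F x₀ (σ i x₀)) :=
      e.continuousOn.continuousAt (e.open_source.mem_nhds (e.mem_source.2 hx₀e))
    exact continuous_snd.continuousAt.comp (ContinuousAt.comp h2 h1)
  have hopen := hcont.preimage_mem_nhds
    (isOpen_setOfPred_linearIndependent.mem_nhds ((hiff x₀ hx₀e).1 hli))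
  filter_upwards [hopen, e.open_baseSet.mem_nhds hx₀e] with x h1 h2
  exact (hiff x h2).2 h1

variable [ContMDiffVectorBundle ω F W 𝓘(ℂ, ℂ)]

/-- Every vector extends to a holomorphic local section. -/
theorem exists_holomorphicSectionOn_eq (x₀ : X) (v : W x₀) :
    ∃ σ : ∀ x, W x, HolomorphicSectionOn F σ (trivializationAt F W x₀).baseSet ∧ σ x₀ = v := by
  let e := trivializationAt F W x₀
  have hx₀e : x₀ ∈ e.baseSet := FiberBundle.mem_baseSet_trivializationAt' x₀
  refine ⟨fun x => e.symm x (e ⟨x₀, v⟩).2, ?_, ?_⟩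
  · refine (e.contMDiffOn_section_baseSet_iff).2 ?_
    refine (contMDiffOn_const (c := (e ⟨x₀, v⟩).2)).congr fun x hx => ?_
    rw [e.mk_symm hx]
    have := e.apply_symm_apply (x := (x, (e ⟨x₀, v⟩).2)) (e.mem_target.2 hx)
    exact (congrArg Prod.snd this :)
  · exact e.symm_apply_apply_mk hx₀e v

/-- The coefficients of a holomorphic section with respect to a holomorphic frame are
holomorphic. -/
theorem contMDiffAt_coeff [FiniteDimensional ℂ F] {ι : Type*} [Fintype ι] {t : ι → ∀ x, W x}
    {U : Set X} (hU : IsOpen U)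
    (ht : ∀ i, HolomorphicSectionOn F (t i) U) {σ : ∀ x, W x} (hσ : HolomorphicSectionOn F σ U)
    {x₀ : X} (hx₀ : x₀ ∈ U) (hli : LinearIndependent ℂ fun i => t i x₀)
    (hspan : Submodule.span ℂ (Set.range fun i => t i x₀) = ⊤)
    {c : ι → X → ℂ} (hc : ∀ x ∈ U, σ x = ∑ i, c i x • t i x) (i : ι) :
    ContMDiffAt 𝓘(ℂ, ℂ) 𝓘(ℂ, ℂ) ω (c i) x₀ := by
  classical
  let e := trivializationAt F W x₀
  have hx₀e : x₀ ∈ e.baseSet := FiberBundle.mem_baseSet_trivializationAt' x₀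
  have hcoord : ∀ {τ : ∀ x, W x}, HolomorphicSectionOn F τ U →
      ContMDiffAt 𝓘(ℂ, ℂ) 𝓘(ℂ, F) ω (fun x => (e ⟨x, τ x⟩).2) x₀ := fun hτ =>
    (e.contMDiffAt_section_iff hx₀e).1 (ContMDiffOn.contMDiffAt hτ (hU.mem_nhds hx₀))
  -- M x sends coefficients to the corresponding combination of the frame, read in the
  -- trivialization. It is invertible at x₀, hence nearby; inversion is analytic, and the
  -- coefficients of σ are M⁻¹ σ.
  let M : X → ((ι → ℂ) →L[ℂ] F) := fun x =>
    ∑ i, (ContinuousLinearMap.smulRightL ℂ (ι → ℂ) F (ContinuousLinearMap.proj i))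
      (e ⟨x, t i x⟩).2
  have hM : ContMDiffAt 𝓘(ℂ, ℂ) 𝓘(ℂ, (ι → ℂ) →L[ℂ] F) ω M x₀ := by
    refine contMDiffAt_finsetSum fun i _ => ?_
    exact (ContinuousLinearMap.contMDiff _).contMDiffAt.comp x₀ (hcoord (ht i))
  have hMapply : ∀ x ∈ e.baseSet, ∀ a : ι → ℂ,
      M x a = (e ⟨x, ∑ i, a i • t i x⟩).2 := fun x hx a => by
    have : (e ⟨x, ∑ i, a i • t i x⟩).2 = e.linearEquivAt ℂ x hx (∑ i, a i • t i x) := rfl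
    rw [this, map_sum]
    simp [M]
  let b : Module.Basis ι ℂ (W x₀) := Module.Basis.mk hli hspan.ge
  let E₀ : (ι → ℂ) ≃ₗ[ℂ] F := b.equivFun.symm.trans (e.linearEquivAt ℂ x₀ hx₀e)
  let E : (ι → ℂ) ≃L[ℂ] F := E₀.toContinuousLinearEquiv
  have hE : M x₀ = (E : (ι → ℂ) →L[ℂ] F) := by
    ext1 a
    rw [hMapply x₀ hx₀e]
    change _ = (e ⟨x₀, b.equivFun.symm a⟩).2
    rw [Module.Basis.equivFun_symm_apply]
    simp only [b, Module.Basis.mk_apply]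
  have hinv : ContMDiffAt 𝓘(ℂ, ℂ) 𝓘(ℂ, F →L[ℂ] (ι → ℂ)) ω
      (ContinuousLinearMap.inverse ∘ M) x₀ := by
    refine ContDiffAt.comp_contMDiffAt ?_ hM
    rw [hE]
    exact contDiffAt_map_inverse E
  have hci : ContMDiffAt 𝓘(ℂ, ℂ) 𝓘(ℂ, ι → ℂ) ω (fun x i => c i x) x₀ := by
    refine (hinv.clm_apply (hcoord hσ)).congr_of_eventuallyEq ?_
    have hnear : ∀ᶠ x in 𝓝 x₀, M x ∈ Set.range ((↑) : ((ι → ℂ) ≃L[ℂ] F) → _) := by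
      refine hM.continuousAt.eventually_mem ?_
      rw [hE]
      exact ContinuousLinearEquiv.nhds E
    filter_upwards [hnear, hU.mem_nhds hx₀, e.open_baseSet.mem_nhds hx₀e] with x h1 h2 h3
    obtain ⟨E', hE'⟩ := h1
    have h4 : (e ⟨x, σ x⟩).2 = E' fun i => c i x := by
      have := hMapply x h3 fun i => c i x
      rw [← hE'] at this
      rw [hc x h2, ← this]; rfl
    simp only [Function.comp_apply, ← hE', ContinuousLinearMap.inverse_equiv, h4]
    simp
  exact (ContinuousLinearMap.contMDiff
    (ContinuousLinearMap.proj (R := ℂ) (φ := fun _ : ι => ℂ) i)).contMDiffAt.comp x₀ hci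

/-- The projection onto a subbundle along a complementary subbundle is holomorphic. -/
theorem HolomorphicSectionOn.projection [FiniteDimensional ℂ F] {S T : HolSubbundle F W}
    (hST : ∀ x, IsCompl (S.fiber x) (T.fiber x)) {σ : ∀ x, W x} {U : Set X} (hU : IsOpen U)
    (hσ : HolomorphicSectionOn F σ U) :
    HolomorphicSectionOn F (fun x => (S.fiber x).projection (T.fiber x) (hST x) (σ x)) U := by
  refine holomorphicSectionOn_of_locally fun x₀ hx₀ => ?_
  obtain ⟨V₁, hV₁, s, hs⟩ := S.exists_isFrameOn x₀
  obtain ⟨V₂, hV₂, t, ht⟩ := T.exists_isFrameOn x₀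
  refine ⟨V₁ ∩ V₂, hs.1.inter ht.1, ⟨hV₁, hV₂⟩, ?_⟩
  set V := U ∩ (V₁ ∩ V₂) with hVdef
  have hV : IsOpen V := hU.inter (hs.1.inter ht.1)
  let r : Fin S.rank ⊕ Fin T.rank → ∀ x, W x := fun i x =>
    Sum.elim (fun i => (s i x : W x)) (fun i => (t i x : W x)) i
  have hr : ∀ i, HolomorphicSectionOn F (r i) V := by
    rintro (i | i)
    · exact (hs.2.1 i).mono fun x hx => hx.2.1
    · exact (ht.2.1 i).mono fun x hx => hx.2.2
  let b : ∀ x, x ∈ V → Module.Basis (Fin S.rank ⊕ Fin T.rank) ℂ (W x) := fun x hx =>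
    ((hs.basis hx.2.1).prod (ht.basis hx.2.2)).map
      (Submodule.prodEquivOfIsCompl (S.fiber x) (T.fiber x) (hST x))
  have hb : ∀ x (hx : x ∈ V), ⇑(b x hx) = fun i => r i x := fun x hx => by
    ext i
    rcases i with i | i <;> simp [b, r, HolSubbundle.IsFrameOn.coe_basis]
  classical
  let c : Fin S.rank ⊕ Fin T.rank → X → ℂ := fun i x =>
    if hx : x ∈ V then (b x hx).repr (σ x) i else 0
  have hc : ∀ x ∈ V, σ x = ∑ i, c i x • r i x := fun x hx => by
    have := (b x hx).sum_repr (σ x)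
    rw [hb x hx] at this
    simp only [c, dif_pos hx]
    exact this.symm
  have hcs : ∀ i, ContMDiffOn 𝓘(ℂ, ℂ) 𝓘(ℂ, ℂ) ω (c i) V := fun i x hx => by
    have hli := (b x hx).linearIndependent
    have hsp := (b x hx).span_eq
    rw [hb x hx] at hli hsp
    exact (contMDiffAt_coeff hV hr (hσ.mono fun x hx => hx.1) hx hli hsp hc i).contMDiffWithinAt
  have hsum : HolomorphicSectionOn F (fun x => ∑ i, c (Sum.inl i) x • r (Sum.inl i) x) V :=
    ContMDiffOn.sum_section fun i _ => (hcs (Sum.inl i)).smul_section (hr (Sum.inl i))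
  refine hsum.congr fun x hx => ?_
  rw [hc x hx, Fintype.sum_sum_type, map_add, map_sum, map_sum]
  have h1 : ∀ i, (S.fiber x).projection (T.fiber x) (hST x) (r (Sum.inl i) x) = r (Sum.inl i) x :=
    fun i => Submodule.projection_apply_left (hST x) (s i x)
  have h2 : ∀ i, (S.fiber x).projection (T.fiber x) (hST x) (r (Sum.inr i) x) = 0 :=
    fun i => Submodule.projection_apply_right (hST x) (t i x)
  simp [h1, h2]

namespace HolSubbundle

variable (F W) in
/-- The zero subbundle. -/
def zero : HolSubbundle F W where
  fiber := ⊥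
  rank := 0
  exists_frame x₀ := ⟨Set.univ, isOpen_univ, trivial, fun i => i.elim0, fun i => i.elim0,
    fun x _ => ⟨linearIndependent_empty_type, by simp⟩⟩

/-- The image of a holomorphic endomorphism of constant rank. -/
def image [FiniteDimensional ℂ F] (A : ∀ x, Module.End ℂ (W x))
    (hA : HolomorphicEndOn F A Set.univ)
    (m : ℕ) (hm : ∀ x, Module.finrank ℂ (LinearMap.range (A x)) = m) : HolSubbundle F W where
  fiber x := LinearMap.range (A x)
  rank := m
  exists_frame x₀ := by
    have := fun x => finiteDimensional_fiber F W x
    -- Preimages of a basis of the range at x₀ extend to local sections. Their images under A stay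
    -- independent near x₀ and, the rank being constant, span the range.
    let b := Module.finBasisOfFinrankEq ℂ (LinearMap.range (A x₀)) (hm x₀)
    choose v hv using fun i => (b i).2
    choose σ hσ hσv using fun i => exists_holomorphicSectionOn_eq (F := F) x₀ (v i)
    set V := (trivializationAt F W x₀).baseSet
    have hV : IsOpen V := (trivializationAt F W x₀).open_baseSet
    have hx₀ : x₀ ∈ V := FiberBundle.mem_baseSet_trivializationAt' x₀
    have hτ : ∀ i, HolomorphicSectionOn F (fun x => A x (σ i x)) V := fun i =>
      hA V (Set.subset_univ V) hV (σ i) (hσ i)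
    have hli₀ : LinearIndependent ℂ fun i => A x₀ (σ i x₀) := by
      have := b.linearIndependent.map' (LinearMap.range (A x₀)).subtype (Submodule.ker_subtype _)
      have heq : (fun i => A x₀ (σ i x₀)) = (LinearMap.range (A x₀)).subtype ∘ b := by
        ext i
        simp [hσv, hv]
      rwa [heq]
    obtain ⟨O, hO, hOo, hxO⟩ := eventually_nhds_iff.1
      (eventually_linearIndependent hV hτ hx₀ hli₀)
    refine ⟨V ∩ O, hV.inter hOo, ⟨hx₀, hxO⟩, fun i x => A x (σ i x),
      fun i => (hτ i).mono Set.inter_subset_left, fun x hx => ⟨hO x hx.2, ?_⟩⟩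
    refine Submodule.eq_of_le_of_finrank_eq (Submodule.span_le.2 ?_) ?_
    · rintro _ ⟨i, rfl⟩
      exact ⟨_, rfl⟩
    · rw [finrank_span_eq_card (hO x hx.2), Fintype.card_fin, hm]

variable (F W) in
/-- The whole bundle. -/
def whole [FiniteDimensional ℂ F] : HolSubbundle F W :=
  image (fun _ => LinearMap.id) (fun _ _ _ _ h => h) (Module.finrank ℂ F)
    fun x => by rw [LinearMap.range_id, finrank_top, finrank_fiber_eq F W]

theorem fiber_whole [FiniteDimensional ℂ F] : (whole F W).fiber = ⊤ :=
  funext fun _ => LinearMap.range_id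

end HolSubbundle
end Sections

/-! ### Linear algebra of twisted endomorphisms in one fibre. -/

section FibreAlgebra

variable {ℓ V : Type*} [AddCommGroup ℓ] [Module ℂ ℓ] [AddCommGroup V] [Module ℂ V]

theorem twistedApply_tmul (l : ℓ) (A : Module.End ℂ V) (w : V) :
    twistedApply (l ⊗ₜ[ℂ] A) w = l ⊗ₜ[ℂ] A w := rfl

theorem tmul_mem_tensorSub (l : ℓ) {M : Submodule ℂ V} {v : V} (hv : v ∈ M) :
    l ⊗ₜ[ℂ] v ∈ tensorSub ℓ M :=
  ⟨l ⊗ₜ[ℂ] (⟨v, hv⟩ : M), rfl⟩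

/-- Contracting with a functional f such that f(l) ≠ 0 sends ℓ ⊗ M into M and l ⊗ v to a nonzero
multiple of v. -/
theorem tmul_mem_tensorSub_iff {l : ℓ} (hl : l ≠ 0) {M : Submodule ℂ V} {v : V} :
    l ⊗ₜ[ℂ] v ∈ tensorSub ℓ M ↔ v ∈ M := by
  refine ⟨fun h => ?_, tmul_mem_tensorSub l⟩
  obtain ⟨f, hf⟩ : ∃ f : Module.Dual ℂ ℓ, f l ≠ 0 := by
    by_contra! h
    exact hl ((Module.forall_dual_apply_eq_zero_iff ℂ l).1 h)
  let g : ℓ ⊗[ℂ] V →ₗ[ℂ] V := (TensorProduct.lid ℂ V).toLinearMap ∘ₗ LinearMap.rTensor V f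
  have hg : ∀ y : ℓ ⊗[ℂ] M, g (LinearMap.lTensor ℓ M.subtype y) ∈ M := fun y => by
    induction y with
    | zero => simp
    | add a b ha hb => rw [map_add, map_add]; exact M.add_mem ha hb
    | tmul a m => simpa [g] using M.smul_mem (f a) m.2
  obtain ⟨y, hy⟩ := h
  have := hg y
  rw [hy] at this
  simpa [g, M.smul_mem_iff hf] using this

theorem twistedInvariant_tmul_iff (l : ℓ) (A : Module.End ℂ V) (M : Submodule ℂ V) :
    TwistedInvariant (l ⊗ₜ[ℂ] A) M ↔ l = 0 ∨ ∀ w ∈ M, A w ∈ M := by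
  rcases eq_or_ne l 0 with rfl | hl
  · simp [TwistedInvariant, twistedApply]
  · simp only [TwistedInvariant, twistedApply_tmul, tmul_mem_tensorSub_iff hl, hl, false_or]

/-- The twisted endomorphisms under which `M` is invariant. -/
def twistedStabilizer (ℓ : Type*) [AddCommGroup ℓ] [Module ℂ ℓ] (M : Submodule ℂ V) :
    Submodule ℂ (ℓ ⊗[ℂ] Module.End ℂ V) :=
  ⨅ w ∈ M, (tensorSub ℓ M).comap
    (LinearMap.lTensor ℓ (LinearMap.applyₗ w : Module.End ℂ V →ₗ[ℂ] V))

theorem mem_twistedStabilizer {M : Submodule ℂ V} {φ : ℓ ⊗[ℂ] Module.End ℂ V} :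
    φ ∈ twistedStabilizer ℓ M ↔ TwistedInvariant φ M := by
  simp [twistedStabilizer, TwistedInvariant, twistedApply]

/-- A map that vanishes on S, or has image in S, preserves S. Because the stabilizer is a subspace,
invariance under elements of N can be tested on these generators. -/
theorem tensorSub_homSub_le_twistedStabilizer {M M' S : Submodule ℂ V} (h : S ≤ M ∨ M' ≤ S) :
    tensorSub ℓ (homSub M M') ≤ twistedStabilizer ℓ S := by
  rintro _ ⟨y, rfl⟩
  induction y with
  | zero => simp
  | add a b ha hb => rw [map_add]; exact Submodule.add_mem _ ha hb
  | tmul l A =>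
    rw [mem_twistedStabilizer]
    refine (twistedInvariant_tmul_iff l (A : Module.End ℂ V) S).2 (Or.inr fun w hw => ?_)
    rcases h with h | h
    · rw [A.2.1 w (h hw)]; exact S.zero_mem
    · exact h (A.2.2 w)

/-- An endomorphism preserving `S` is a sum of one with image in `S` and one vanishing on `S`. -/
theorem tmul_mem_sup_of_twistedInvariant {l : ℓ} {A : Module.End ℂ V} {S : Submodule ℂ V}
    (h : TwistedInvariant (l ⊗ₜ[ℂ] A) S) :
    l ⊗ₜ[ℂ] A ∈ tensorSub ℓ (homSub ⊥ S) ⊔ tensorSub ℓ (homSub S ⊤) := by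
  rcases (twistedInvariant_tmul_iff l A S).1 h with rfl | hA
  · simp
  · obtain ⟨S', hS'⟩ := S.exists_isCompl
    let p : Module.End ℂ V := S.projection S' hS'
    have hsplit : A = A ∘ₗ p + A ∘ₗ (LinearMap.id - p) := by
      ext v; simp
    rw [hsplit, TensorProduct.tmul_add]
    refine Submodule.add_mem_sup (tmul_mem_tensorSub l ⟨fun v hv => ?_, fun v => ?_⟩)
      (tmul_mem_tensorSub l ⟨fun v hv => ?_, fun v => trivial⟩)
    · rw [(Submodule.mem_bot ℂ).1 hv, map_zero]
    · exact hA _ (Submodule.projection_apply_mem hS' v)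
    · have : p v = v := Submodule.projection_apply_of_mem_left hS' hv
      simp [this]

/-- Given projections `q i` along the steps of a filtration, the graded pieces add up. -/
theorem bijective_sum_projections [FiniteDimensional ℂ V] {k : ℕ} {M : ℕ → Submodule ℂ V}
    (h0 : M 0 = ⊥)
    (hk : M k = ⊤) (hM : ∀ i < k, M i ≤ M (i + 1)) {q : ℕ → Module.End ℂ V}
    (hq : ∀ i < k, ∀ v, q i v - v ∈ M i)
    (g : (∀ i : Fin k, M (i + 1) ⧸ (M i).submoduleOf (M (i + 1))) →ₗ[ℂ] V)
    (hg : ∀ (i : Fin k) (w : M (i + 1)), g (Pi.single i (Submodule.Quotient.mk w)) = q i w) :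
    Function.Bijective g := by
  have hsurj : Function.Surjective g := by
    rw [← LinearMap.range_eq_top, eq_top_iff, ← hk]
    -- For v in M (j + 1), the vector q j v lies in the range and differs from v by an element of M
    -- j, which the induction covers. Injectivity then follows from a telescoping dimension count.
    have key : ∀ j ≤ k, M j ≤ LinearMap.range g := by
      intro j
      induction j with
      | zero => intro _; rw [h0]; exact bot_le
      | succ j ih =>
        intro hj v hv
        have h1 := ih (Nat.le_of_succ_le hj) (hq j hj v)
        have h2 : q j v ∈ LinearMap.range g := ⟨_, hg ⟨j, hj⟩ ⟨v, hv⟩⟩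
        simpa using Submodule.sub_mem _ h2 h1
    exact key k le_rfl
  refine ⟨(LinearMap.injective_iff_surjective_of_finrank_eq_finrank ?_).2 hsurj, hsurj⟩
  rw [Module.finrank_pi_fintype]
  have hr : ∀ i : Fin k, Module.finrank ℂ (M (i + 1) ⧸ (M i).submoduleOf (M (i + 1))) +
      Module.finrank ℂ (M i) = Module.finrank ℂ (M (i + 1)) := fun i => by
    rw [← Submodule.finrank_quotient_add_finrank ((M i).submoduleOf (M (i + 1))),
      (Submodule.submoduleOfEquivOfLe (hM i i.2)).finrank_eq]
  have hsum := Finset.sum_range_sub (fun i => (Module.finrank ℂ (M i) : ℤ)) k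
  rw [← Fin.sum_univ_eq_sum_range
    (fun i => (Module.finrank ℂ (M (i + 1)) : ℤ) - Module.finrank ℂ (M i))] at hsum
  rw [h0, hk, finrank_bot, finrank_top, Nat.cast_zero, sub_zero] at hsum
  zify
  rw [← hsum]
  refine Finset.sum_congr rfl fun i _ => ?_
  rw [← hr i]
  simp

end FibreAlgebra

/-! ### Filtrations and invariant subbundles; two-step filtrations; splittings and complements. -/

section Pairs

variable {X : Type*} [TopologicalSpace X] [ChartedSpace ℂ X]
  {F : Type*} [NormedAddCommGroup F] [NormedSpace ℂ F]
  {W : X → Type*} [∀ x, AddCommGroup (W x)] [∀ x, Module ℂ (W x)]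
  [∀ x, TopologicalSpace (W x)] [TopologicalSpace (TotalSpace F W)] [FiberBundle F W]
  {L : X → Type*} [∀ x, AddCommGroup (L x)] [∀ x, Module ℂ (L x)]
  [∀ x, TopologicalSpace (L x)] [TopologicalSpace (TotalSpace ℂ L)] [FiberBundle ℂ L]

/-- The local form demanded by holomorphy makes each value of Φ a pure tensor, so that invariance
becomes a question about one ordinary endomorphism (or is void where l = 0). -/
theorem HiggsPair.exists_field_eq_tmul (P : HiggsPair F W L) (x : X) :
    ∃ (l : L x) (A : Module.End ℂ (W x)), P.field x = l ⊗ₜ[ℂ] A := by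
  obtain ⟨U, -, hx, l, A, -, -, h⟩ := P.holomorphic x
  exact ⟨l x, A x, h x hx⟩

theorem HiggsPair.twistedInvariant_inf (P : HiggsPair F W L) {x : X} {M M' : Submodule ℂ (W x)}
    (h : TwistedInvariant (P.field x) M) (h' : TwistedInvariant (P.field x) M') :
    TwistedInvariant (P.field x) (M ⊓ M') := by
  obtain ⟨l, A, hlA⟩ := P.exists_field_eq_tmul x
  rw [hlA, twistedInvariant_tmul_iff] at h h' ⊢
  rcases h with h | h
  · exact Or.inl h
  · rcases h' with h' | h'
    · exact Or.inl h'
    · exact Or.inr fun w hw => ⟨h w hw.1, h' w hw.2⟩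

theorem twistedInvariant_bot {ℓ V : Type*} [AddCommGroup ℓ] [Module ℂ ℓ] [AddCommGroup V]
    [Module ℂ V] (φ : ℓ ⊗[ℂ] Module.End ℂ V) : TwistedInvariant φ (⊥ : Submodule ℂ V) := by
  intro w hw
  rw [(Submodule.mem_bot ℂ).1 hw]
  simp [twistedApply]

theorem twistedInvariant_top {ℓ V : Type*} [AddCommGroup ℓ] [Module ℂ ℓ] [AddCommGroup V]
    [Module ℂ V] (φ : ℓ ⊗[ℂ] Module.End ℂ V) : TwistedInvariant φ (⊤ : Submodule ℂ V) := by
  intro w _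
  rw [tensorSub, LinearMap.range_eq_top.2]
  · trivial
  · exact LinearMap.lTensor_surjective ℓ fun v => ⟨⟨v, trivial⟩, rfl⟩

namespace Filtration

variable (𝒲 : Filtration F W)

theorem fiber_mono {i j : ℕ} (hij : i ≤ j) (hj : j ≤ 𝒲.k) :
    (𝒲.sub i).fiber ≤ (𝒲.sub j).fiber := by
  induction j, hij using Nat.le_induction with
  | base => exact le_rfl
  | succ j _ ih => exact (ih (Nat.le_of_succ_le hj)).trans (𝒲.strict j hj).le

theorem fiber_ne_bot {j : ℕ} (hj0 : 1 ≤ j) (hj : j ≤ 𝒲.k) : (𝒲.sub j).fiber ≠ ⊥ := by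
  have h : (𝒲.sub 0).fiber < (𝒲.sub 1).fiber := 𝒲.strict 0 (hj0.trans hj)
  rw [𝒲.bot] at h
  exact (h.trans_le (𝒲.fiber_mono hj0 hj)).ne'

theorem fiber_ne_top {j : ℕ} (hj : j < 𝒲.k) : (𝒲.sub j).fiber ≠ ⊤ := by
  have h : (𝒲.sub j).fiber < (𝒲.sub (j + 1)).fiber := 𝒲.strict j hj
  exact (h.trans_le le_top).ne

variable {𝒲}

theorem IsWeight.mono {lam : ℕ → ℝ} (h : 𝒲.IsWeight lam) {i j : ℕ} (hi : 1 ≤ i) (hij : i ≤ j)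
    (hj : j ≤ 𝒲.k) : lam i ≤ lam j := by
  induction j, hij using Nat.le_induction with
  | base => exact le_rfl
  | succ j hij ih =>
    exact (ih (Nat.le_of_succ_le hj)).trans (h.1 j (Finset.mem_Ico.2 ⟨hi.trans hij, hj⟩))

/-- Where the weight jumps, the step of the filtration is invariant. -/
theorem IsWeight.twistedInvariant {L' : X → Type*} [∀ x, AddCommGroup (L' x)]
    [∀ x, Module ℂ (L' x)] {lam : ℕ → ℝ} (h : 𝒲.IsWeight lam) {j : ℕ}
    (hj : j ∈ Finset.Ico 1 𝒲.k) (hlt : lam j < lam (j + 1)) {x : X}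
    {φ : L' x ⊗[ℂ] Module.End ℂ (W x)} (hφ : φ ∈ 𝒲.N L' lam x) :
    TwistedInvariant φ ((𝒲.sub j).fiber x) := by
  rw [Finset.mem_Ico] at hj
  rw [← mem_twistedStabilizer]
  refine SetLike.le_def.1 (iSup₂_le fun a ha => iSup₂_le fun b hb => iSup_le fun hab => ?_) hφ.2
  rw [Finset.mem_Icc] at ha hb
  refine tensorSub_homSub_le_twistedStabilizer ?_
  rcases Nat.lt_or_ge j a with hja | hja
  · exact Or.inl (𝒲.fiber_mono (by omega) (by omega) x)
  · refine Or.inr (𝒲.fiber_mono ?_ hj.2.le x)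
    by_contra! hjb
    have h1 := h.mono ha.1 hja hj.2.le
    have h2 := h.mono (Nat.le_add_left 1 j) hjb hb.2
    linarith

/-- A nonzero weight jumps at some proper step of the filtration. -/
theorem IsWeight.exists_lt [Nonempty X] {lam : ℕ → ℝ} (h : 𝒲.IsWeight lam)
    (hne : ∃ i ∈ Finset.Icc 1 𝒲.k, lam i ≠ 0) :
    ∃ j ∈ Finset.Ico 1 𝒲.k, lam j < lam (j + 1) := by
  by_contra! hcon
  have heq : ∀ j ∈ Finset.Ico 1 𝒲.k, lam j = lam (j + 1) := fun j hj =>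
    le_antisymm (h.1 j hj) (hcon j hj)
  obtain ⟨i, hi, hi0⟩ := hne
  rw [Finset.mem_Icc] at hi
  have hk : ∀ j, i ≤ j → j ≤ 𝒲.k → lam j = lam i := fun j hij => by
    induction j, hij using Nat.le_induction with
    | base => exact fun _ => rfl
    | succ j hij ih =>
      intro hj
      rw [← heq j (Finset.mem_Ico.2 ⟨hi.1.trans hij, hj⟩), ih (Nat.le_of_succ_le hj)]
  have hsum := h.2
  rw [Finset.sum_eq_zero fun j hj => by rw [heq j hj, sub_self, mul_zero], zero_add,
    hk 𝒲.k hi.2 le_rfl] at hsum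
  -- Without jumps the trace condition reads rk W · λ_k = 0 with λ_k = λ_i ≠ 0, so W would be zero,
  -- whereas W_k strictly contains W₀.
  have hrank : (𝒲.sub 𝒲.k).rank = 0 := by
    exact_mod_cast (mul_eq_zero.1 hsum).resolve_right hi0
  refine 𝒲.fiber_ne_bot (hi.1.trans hi.2) le_rfl (funext fun x => ?_)
  have := (𝒲.sub 𝒲.k).finite_fiber x
  exact Submodule.finrank_eq_zero.1 (((𝒲.sub 𝒲.k).finrank_fiber x).trans hrank)

theorem IsWeight.mul_degree_nonneg {lam : ℕ → ℝ} (h : 𝒲.IsWeight lam) {j : ℕ}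
    (hj : j ∈ Finset.Ico 1 𝒲.k)
    (hdeg : lam j < lam (j + 1) → (𝒲.sub j).degree ≤ 0) :
    0 ≤ (lam j - lam (j + 1)) * ((𝒲.sub j).degree : ℝ) := by
  rcases (h.1 j hj).lt_or_eq with hlt | heq
  · exact mul_nonneg_of_nonpos_of_nonpos (sub_nonpos.2 hlt.le) (by exact_mod_cast hdeg hlt)
  · simp [heq]

end Filtration

theorem rank_pos_of_fiber_ne_bot {S : HolSubbundle F W} (h0 : S.fiber ≠ ⊥) : 0 < S.rank := by
  rw [Nat.pos_iff_ne_zero]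
  intro h
  refine h0 (funext fun x => ?_)
  have := S.finite_fiber x
  exact Submodule.finrank_eq_zero.1 ((S.finrank_fiber x).trans h)

theorem finrank_pos_of_fiber_ne_bot [VectorBundle ℂ F W] [FiniteDimensional ℂ F]
    {S : HolSubbundle F W} (h0 : S.fiber ≠ ⊥) : 0 < Module.finrank ℂ F := by
  obtain ⟨x, -⟩ := Function.ne_iff.1 h0
  have := finiteDimensional_fiber F W x
  rw [← finrank_fiber_eq F W x]
  refine (rank_pos_of_fiber_ne_bot h0).trans_le ?_
  rw [← S.finrank_fiber x]
  exact Submodule.finrank_le _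

/-- The weights of the filtration `0 ⊊ S ⊊ W`. -/
def twoStepWeight (S : HolSubbundle F W) (i : ℕ) : ℝ :=
  if i = 1 then S.rank - Module.finrank ℂ F else S.rank

theorem twoStepWeight_lt [VectorBundle ℂ F W] [FiniteDimensional ℂ F]
    {S : HolSubbundle F W} (h0 : S.fiber ≠ ⊥) : twoStepWeight S 1 < twoStepWeight S 2 := by
  have : (0 : ℝ) < Module.finrank ℂ F := by exact_mod_cast finrank_pos_of_fiber_ne_bot h0
  simp [twoStepWeight, this]

section TwoStep

variable [VectorBundle ℂ F W] [ContMDiffVectorBundle ω F W 𝓘(ℂ, ℂ)] [FiniteDimensional ℂ F]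

/-- The filtration `0 ⊊ S ⊊ W`. -/
def twoStep (S : HolSubbundle F W) (h0 : S.fiber ≠ ⊥) (h1 : S.fiber ≠ ⊤) : Filtration F W where
  k := 2
  sub
    | 0 => HolSubbundle.zero F W
    | 1 => S
    | _ => HolSubbundle.whole F W
  bot := rfl
  top := HolSubbundle.fiber_whole
  strict i hi := by
    have hS0 : HolSubbundle.zero F W < S := bot_lt_iff_ne_bot.2 h0
    have hS1 : S < HolSubbundle.whole F W := by
      change S.fiber < (HolSubbundle.whole F W).fiber
      rw [HolSubbundle.fiber_whole]
      exact lt_top_iff_ne_top.2 h1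
    match i, hi with
    | 0, _ => exact hS0
    | 1, _ => exact hS1

variable {S : HolSubbundle F W}

/-- With r = rk S and n = rk W, the trace condition is r((r - n) - r) + n r = 0. -/
theorem isWeight_twoStep (h0 : S.fiber ≠ ⊥) (h1 : S.fiber ≠ ⊤) :
    (twoStep S h0 h1).IsWeight (twoStepWeight S) := by
  have hI : Finset.Ico 1 (twoStep S h0 h1).k = {1} := rfl
  refine ⟨fun i hi => ?_, ?_⟩
  · rw [hI, Finset.mem_singleton] at hi
    rw [hi]
    exact (twoStepWeight_lt h0).le
  · rw [hI, Finset.sum_singleton]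
    have h2 : ((twoStep S h0 h1).sub (twoStep S h0 h1).k).rank = Module.finrank ℂ F := rfl
    have h3 : ((twoStep S h0 h1).sub 1).rank = S.rank := rfl
    have h4 : (twoStep S h0 h1).k = 2 := rfl
    rw [h2, h3, h4]
    simp [twoStepWeight]
    ring

theorem d_twoStep (h0 : S.fiber ≠ ⊥) (h1 : S.fiber ≠ ⊤) :
    (twoStep S h0 h1).d (twoStepWeight S) = -(Module.finrank ℂ F : ℝ) * S.degree := by
  have hI : Finset.Ico 1 (twoStep S h0 h1).k = {1} := rfl
  have h3 : (twoStep S h0 h1).sub 1 = S := rfl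
  rw [Filtration.d, hI, Finset.sum_singleton, h3]
  simp [twoStepWeight]

/-- Only the diagonal summands i = j are needed: Hom(W, S) for i = 1 and Hom(W/S, W) for i = 2
already span the endomorphisms preserving S. -/
theorem field_mem_N_twoStep (h0 : S.fiber ≠ ⊥) (h1 : S.fiber ≠ ⊤)
    (P : HiggsPair F W L) (hS : P.Invariant S) (x : X) :
    P.field x ∈ (twoStep S h0 h1).N L (twoStepWeight S) x := by
  refine ⟨P.traceless x, ?_⟩
  have hx := hS x
  obtain ⟨l, A, hlA⟩ := P.exists_field_eq_tmul x
  rw [hlA] at hx ⊢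
  have hmem := tmul_mem_sup_of_twistedInvariant hx
  have hle : ∀ i ∈ Finset.Icc 1 2, tensorSub (L x) (homSub (((twoStep S h0 h1).sub (i - 1)).fiber x)
      (((twoStep S h0 h1).sub i).fiber x)) ≤
        ⨆ i ∈ Finset.Icc 1 (twoStep S h0 h1).k, ⨆ j ∈ Finset.Icc 1 (twoStep S h0 h1).k,
          ⨆ _ : twoStepWeight S j ≤ twoStepWeight S i, tensorSub (L x)
            (homSub (((twoStep S h0 h1).sub (i - 1)).fiber x)
              (((twoStep S h0 h1).sub j).fiber x)) := fun i hi =>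
    le_iSup₂_of_le i hi (le_iSup₂_of_le i hi (le_iSup_of_le le_rfl le_rfl))
  refine sup_le (hle 1 (by simp)) ?_ hmem
  have h2 := hle 2 (by simp)
  have htop : ((twoStep S h0 h1).sub 2).fiber x = ⊤ := congrFun HolSubbundle.fiber_whole x
  rw [htop] at h2
  exact h2

theorem HiggsPair.Semistable.degree_nonpos_of_ne {P : HiggsPair F W L} (hP : P.Semistable)
    (h0 : S.fiber ≠ ⊥) (h1 : S.fiber ≠ ⊤) (hS : P.Invariant S) : S.degree ≤ 0 := by
  have := hP _ _ (isWeight_twoStep h0 h1) (field_mem_N_twoStep h0 h1 P hS)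
  rw [d_twoStep] at this
  have hn : (0 : ℝ) < Module.finrank ℂ F := by exact_mod_cast finrank_pos_of_fiber_ne_bot h0
  have h2 : (S.degree : ℝ) ≤ 0 := by nlinarith
  exact_mod_cast h2

theorem HiggsPair.Stable.degree_neg {P : HiggsPair F W L} (hP : P.Stable)
    (h0 : S.fiber ≠ ⊥) (h1 : S.fiber ≠ ⊤) (hS : P.Invariant S) : S.degree < 0 := by
  have := hP.2 _ _ (isWeight_twoStep h0 h1)
    -- The weight is not identically zero: its second entry is rk S > 0.
    ⟨2, by simp [twoStep], by
      have := rank_pos_of_fiber_ne_bot h0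
      simp [twoStepWeight, this.ne']⟩ (field_mem_N_twoStep h0 h1 P hS)
  rw [d_twoStep] at this
  have hn : (0 : ℝ) < Module.finrank ℂ F := by exact_mod_cast finrank_pos_of_fiber_ne_bot h0
  have h2 : (S.degree : ℝ) < 0 := by nlinarith
  exact_mod_cast h2

/-- A splitting of a filtration with two steps provides a complement of the smaller one. -/
theorem exists_complement_of_splitting {𝒲 : Filtration F W} (e : 𝒲.Splitting) {i₀ i₁ : Fin 𝒲.k}
    (hne : i₀ ≠ i₁) (hi : ∀ i, i = i₀ ∨ i = i₁) (hbot : (𝒲.sub i₀).fiber = ⊥)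
    (htop : (𝒲.sub (i₁ + 1)).fiber = ⊤) :
    ∃ T : HolSubbundle F W, T.fiber = e.summand i₁ ∧
      ∀ x, IsCompl ((𝒲.sub (i₀ + 1)).fiber x) (T.fiber x) := by
  classical
  have hmem : ∀ x (v : W x), v ∈ (𝒲.sub (i₁ + 1)).fiber x := fun x v => by rw [htop]; trivial
  have hS : ∀ x, e.summand i₀ x = (𝒲.sub (i₀ + 1)).fiber x := fun x => by
    -- Since W_{i₀} = 0, the splitting condition makes the isomorphism the plain inclusion on this
    -- summand.
    have hsplit : ∀ w : (𝒲.sub (i₀ + 1)).fiber x,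
        e.iso x (Pi.single i₀ (Submodule.Quotient.mk w)) = w := fun w =>
      have hle : (𝒲.sub i₀).fiber x ≤ ⊥ := by rw [hbot]; exact le_rfl
      sub_eq_zero.1 ((Submodule.mem_bot ℂ).1 (hle (e.split i₀ x w)))
    ext v
    constructor
    · rintro ⟨u, rfl⟩
      obtain ⟨w, rfl⟩ := Submodule.Quotient.mk_surjective _ u
      change e.iso x (Pi.single i₀ (Submodule.Quotient.mk w)) ∈ _
      rw [hsplit w]; exact w.2
    · intro hv
      exact ⟨Submodule.Quotient.mk ⟨v, hv⟩, hsplit ⟨v, hv⟩⟩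
  have hcompl : ∀ x, IsCompl ((𝒲.sub (i₀ + 1)).fiber x) (e.summand i₁ x) := fun x => by
    rw [← hS x]
    refine ⟨Submodule.disjoint_def.2 ?_, codisjoint_iff.2 (eq_top_iff.2 fun v _ => ?_)⟩
    · rintro _ ⟨a, rfl⟩ ⟨b, hb⟩
      have h2 : Pi.single (M := fun i : Fin 𝒲.k => 𝒲.Gr i x) i₁ b = Pi.single i₀ a :=
        (e.iso x).injective hb
      have h3 : a = 0 := by
        have := congrFun h2 i₀
        rw [Pi.single_eq_same, Pi.single_eq_of_ne hne] at this
        exact this.symm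
      rw [h3, map_zero]
    · obtain ⟨u, rfl⟩ := (e.iso x).surjective v
      have hu : u = Pi.single (M := fun i : Fin 𝒲.k => 𝒲.Gr i x) i₀ (u i₀) +
          Pi.single i₁ (u i₁) := by
        ext i
        rcases hi i with rfl | rfl
        · rw [Pi.add_apply, Pi.single_eq_same, Pi.single_eq_of_ne hne, add_zero]
        · rw [Pi.add_apply, Pi.single_eq_same, Pi.single_eq_of_ne hne.symm, zero_add]
      rw [hu, map_add]
      exact Submodule.add_mem_sup ⟨_, rfl⟩ ⟨_, rfl⟩
  -- The composite of the quotient map with the splitting is a holomorphic endomorphism of constant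
  -- rank whose range is the second summand; `image` then makes it a subbundle.
  let A : ∀ x, Module.End ℂ (W x) := fun x =>
    (e.iso x).toLinearMap ∘ₗ LinearMap.single ℂ (fun i : Fin 𝒲.k => 𝒲.Gr i x) i₁ ∘ₗ
      Submodule.mkQ _ ∘ₗ LinearMap.codRestrict ((𝒲.sub (i₁ + 1)).fiber x) LinearMap.id (hmem x)
  have hrange : ∀ x, LinearMap.range (A x) = e.summand i₁ x := fun x => by
    ext v
    constructor
    · rintro ⟨w, rfl⟩
      exact ⟨_, rfl⟩
    · rintro ⟨u, rfl⟩
      obtain ⟨w, rfl⟩ := Submodule.Quotient.mk_surjective _ u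
      exact ⟨w, rfl⟩
  have hA : HolomorphicEndOn F A Set.univ := by
    intro V _ hV σ hσ
    have := e.holomorphic V hV
      (fun i x => if h : i = i₁ then ⟨σ x, h ▸ hmem x (σ x)⟩ else 0) fun i => by
        by_cases h : i = i₁
        · simpa [h] using hσ
        · simpa [h] using holomorphicSectionOn_zero V
    refine this.congr fun x _ => ?_
    change e.iso x (Pi.single i₁ (Submodule.Quotient.mk ⟨σ x, hmem x (σ x)⟩)) = _
    congr 1
    ext i
    by_cases h : i = i₁
    · subst h
      simp
    · simp [h]
  have hm : ∀ x, Module.finrank ℂ (LinearMap.range (A x)) =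
      Module.finrank ℂ F - (𝒲.sub (i₀ + 1)).rank := fun x => by
    have := finiteDimensional_fiber F W x
    have h := Submodule.finrank_add_eq_of_isCompl (hcompl x)
    rw [hrange, ← finrank_fiber_eq F W x, ← (𝒲.sub (i₀ + 1)).finrank_fiber x]
    omega
  exact ⟨HolSubbundle.image A hA _ hm, funext hrange, fun x => by
    change IsCompl _ (LinearMap.range (A x))
    rw [hrange]; exact hcompl x⟩

end TwoStep

/-- Complements of the steps of a filtration provide a splitting. -/
theorem exists_splitting_of_complements [VectorBundle ℂ F W] [ContMDiffVectorBundle ω F W 𝓘(ℂ, ℂ)]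
    [FiniteDimensional ℂ F] (𝒲 : Filtration F W) (T : ℕ → HolSubbundle F W)
    (hT : ∀ i < 𝒲.k, ∀ x, IsCompl ((T i).fiber x) ((𝒲.sub i).fiber x)) :
    ∃ e : 𝒲.Splitting, ∀ i x,
      e.summand i x = (T i).fiber x ⊓ (𝒲.sub (i + 1)).fiber x := by
  have := fun x => finiteDimensional_fiber F W x
  classical
  let q : ∀ x, ℕ → Module.End ℂ (W x) := fun x i =>
    if h : i < 𝒲.k then ((T i).fiber x).projection ((𝒲.sub i).fiber x) (hT i h x) else 0
  have hqdef : ∀ x, ∀ i (h : i < 𝒲.k),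
      q x i = ((T i).fiber x).projection ((𝒲.sub i).fiber x) (hT i h x) := fun x i h => dif_pos h
  have hq : ∀ x, ∀ i < 𝒲.k, ∀ v, q x i v - v ∈ (𝒲.sub i).fiber x := fun x i h v => by
    rw [hqdef x i h, ← Submodule.projection_apply_eq_zero_iff (hT i h x), map_sub,
      Submodule.projection_apply_of_mem_left _ (Submodule.projection_apply_mem _ v), sub_self]
  -- Projection along W_i kills W_i, hence descends to W_{i+1}/W_i; its image there is T_i ∩
  -- W_{i+1}.
  let f : ∀ x, ∀ i : Fin 𝒲.k, 𝒲.Gr i x →ₗ[ℂ] W x := fun x i =>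
    Submodule.liftQ _ (q x i ∘ₗ ((𝒲.sub (i + 1)).fiber x).subtype) fun v hv => by
      rw [LinearMap.mem_ker, hqdef x i i.2]
      exact Submodule.projection_apply_of_mem_right _ hv
  have hf : ∀ x (i : Fin 𝒲.k) (w : (𝒲.sub (i + 1)).fiber x),
      f x i (Submodule.Quotient.mk w) = q x i w := fun x i w => rfl
  let g : ∀ x, (∀ i : Fin 𝒲.k, 𝒲.Gr i x) →ₗ[ℂ] W x := fun x => LinearMap.lsum ℂ _ ℂ (f x)
  have hgs : ∀ x (i : Fin 𝒲.k) (u : 𝒲.Gr i x), g x (Pi.single i u) = f x i u := fun x i u =>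
    LinearMap.lsum_piSingle ℂ _ ℂ (f x) i u
  have hgsum : ∀ x (u : ∀ i : Fin 𝒲.k, 𝒲.Gr i x), g x u = ∑ i, f x i (u i) := fun x u => by
    simp only [g, LinearMap.lsum_apply, LinearMap.sum_apply]
    rfl
  have hg : ∀ x, Function.Bijective (g x) := fun x =>
    bijective_sum_projections (M := fun i => (𝒲.sub i).fiber x) (congrFun 𝒲.bot x)
      (congrFun 𝒲.top x) (fun i hi => 𝒲.fiber_mono (Nat.le_succ i) hi x) (hq x) (g x)
      fun i w => by rw [hgs, hf]
  refine ⟨⟨fun x => LinearEquiv.ofBijective (g x) (hg x), fun U hU σ hσ => ?_, fun i x w => ?_⟩,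
    fun i x => ?_⟩
  · have hsum : HolomorphicSectionOn F (fun x => ∑ i : Fin 𝒲.k,
        ((T i).fiber x).projection ((𝒲.sub i).fiber x) (hT i i.2 x) (σ i x)) U :=
      ContMDiffOn.sum_section fun i _ => (hσ i).projection (hT i i.2) hU
    refine hsum.congr fun x _ => ?_
    change g x _ = _
    rw [hgsum]
    refine Finset.sum_congr rfl fun i _ => ?_
    rw [← hqdef x i i.2, ← hf]
  · change g x _ - _ ∈ _
    rw [hgs, hf]
    exact hq x i i.2 w
  · ext v
    constructor
    · rintro ⟨u, rfl⟩
      obtain ⟨w, rfl⟩ := Submodule.Quotient.mk_surjective _ u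
      change g x (Pi.single i (Submodule.Quotient.mk w)) ∈ _
      rw [hgs, hf]
      refine ⟨?_, ?_⟩
      · rw [hqdef x i i.2]; exact Submodule.projection_apply_mem _ _
      · have h1 := 𝒲.fiber_mono (Nat.le_succ i) i.2 x (hq x i i.2 w)
        simpa using Submodule.add_mem _ h1 w.2
    · rintro ⟨hv1, hv2⟩
      refine ⟨Submodule.Quotient.mk ⟨v, hv2⟩, ?_⟩
      change g x (Pi.single i (Submodule.Quotient.mk _)) = _
      rw [hgs, hf, hqdef x i i.2]
      exact Submodule.projection_apply_of_mem_left _ hv1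

end Pairs

/-! ### The three equivalences. -/

section Characterization

variable {X : Type*} [TopologicalSpace X] [ChartedSpace ℂ X]
  {F : Type*} [NormedAddCommGroup F] [NormedSpace ℂ F]
  {W : X → Type*} [∀ x, AddCommGroup (W x)] [∀ x, Module ℂ (W x)]
  [∀ x, TopologicalSpace (W x)] [TopologicalSpace (TotalSpace F W)] [FiberBundle F W]
  {L : X → Type*} [∀ x, AddCommGroup (L x)] [∀ x, Module ℂ (L x)]
  [∀ x, TopologicalSpace (L x)] [TopologicalSpace (TotalSpace ℂ L)] [FiberBundle ℂ L]

namespace HiggsPair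

variable {P : HiggsPair F W L}

/-- At a jump W_j is invariant, so its term in d is a product of two nonpositive numbers; elsewhere
the term is zero. Only steps with 1 ≤ j < k occur, so proper nonzero subbundles suffice. -/
theorem semistable_of_degree_nonpos
    (h : ∀ S : HolSubbundle F W, S.fiber ≠ ⊥ → S.fiber ≠ ⊤ → P.Invariant S → S.degree ≤ 0) :
    P.Semistable := fun 𝒲 _ hw hP => Finset.sum_nonneg fun _ hj =>
  hw.mul_degree_nonneg hj fun hlt => h _
    (𝒲.fiber_ne_bot (Finset.mem_Ico.1 hj).1 (Finset.mem_Ico.1 hj).2.le)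
    (𝒲.fiber_ne_top (Finset.mem_Ico.1 hj).2) fun x => hw.twistedInvariant hj hlt (hP x)

theorem stable_of_degree_neg [Nonempty X]
    (h : ∀ S : HolSubbundle F W, S.fiber ≠ ⊥ → S.fiber ≠ ⊤ → P.Invariant S → S.degree < 0) :
    P.Stable := by
  refine ⟨semistable_of_degree_nonpos fun S h0 h1 hS => (h S h0 h1 hS).le,
    fun 𝒲 lam hw hne hP => ?_⟩
  have hdeg : ∀ j ∈ Finset.Ico 1 𝒲.k, lam j < lam (j + 1) → (𝒲.sub j).degree < 0 :=
    fun j hj hlt => h _ (𝒲.fiber_ne_bot (Finset.mem_Ico.1 hj).1 (Finset.mem_Ico.1 hj).2.le)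
      (𝒲.fiber_ne_top (Finset.mem_Ico.1 hj).2) fun x => hw.twistedInvariant hj hlt (hP x)
  obtain ⟨j, hj, hlt⟩ := hw.exists_lt hne
  refine Finset.sum_pos' (fun i hi => hw.mul_degree_nonneg hi fun h => (hdeg i hi h).le)
    ⟨j, hj, mul_pos_of_neg_of_neg (sub_neg.2 hlt) ?_⟩
  exact_mod_cast hdeg j hj hlt

variable [VectorBundle ℂ F W] [ContMDiffVectorBundle ω F W 𝓘(ℂ, ℂ)] [FiniteDimensional ℂ F]

theorem Polystable.exists_isCompl (hP : P.Polystable) {S : HolSubbundle F W}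
    (hS : P.Invariant S) (hdeg : S.degree = 0) :
    ∃ T : HolSubbundle F W, P.Invariant T ∧ ∀ x, IsCompl (S.fiber x) (T.fiber x) := by
  -- The two-step filtration needs strict inclusions; 0 and W are instead complements of each other.
  by_cases h0 : S.fiber = ⊥
  · have hT : ∀ x, (HolSubbundle.whole F W).fiber x = ⊤ := congrFun HolSubbundle.fiber_whole
    refine ⟨HolSubbundle.whole F W, fun x => ?_, fun x => ?_⟩
    · rw [hT]; exact twistedInvariant_top _
    · rw [hT, h0]; exact isCompl_bot_top
  by_cases h1 : S.fiber = ⊤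
  · refine ⟨HolSubbundle.zero F W, fun x => twistedInvariant_bot _, fun x => ?_⟩
    rw [h1]; exact isCompl_top_bot
  obtain ⟨e, he⟩ := hP.2 (twoStep S h0 h1) (twoStepWeight S) (isWeight_twoStep h0 h1)
    (fun i hi => by
      have hi : i ∈ ({1} : Finset ℕ) := hi
      rw [Finset.mem_singleton.1 hi]
      exact twoStepWeight_lt h0)
    (field_mem_N_twoStep h0 h1 P hS) (by rw [d_twoStep, hdeg]; simp)
  -- Graded pieces are numbered from 0: index 0 is S itself and index 1 is W/S.
  obtain ⟨T, hT, hc⟩ := exists_complement_of_splitting e (i₀ := (0 : Fin 2)) (i₁ := (1 : Fin 2))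
    (by decide : (0 : Fin 2) ≠ 1) (by decide : ∀ i : Fin 2, i = 0 ∨ i = 1) rfl
    HolSubbundle.fiber_whole
  refine ⟨T, fun x => ?_, hc⟩
  rw [hT]
  exact he _ x

variable [IsManifold 𝓘(ℂ, ℂ) ω X] [CompactSpace X] [T2Space X] [ConnectedSpace X]

theorem Semistable.degree_nonpos (hP : P.Semistable) {S : HolSubbundle F W}
    (hS : P.Invariant S) : S.degree ≤ 0 := by
  by_cases h0 : S.fiber = ⊥
  · exact (HolSubbundle.degree_eq_zero_of_fiber_eq_bot h0).le
  by_cases h1 : S.fiber = ⊤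
  · exact (HolSubbundle.degree_eq_zero_of_fiber_eq_top h1 P.det (finrank_fiber_eq F W)).le
  exact hP.degree_nonpos_of_ne h0 h1 hS

theorem polystable_of_exists_isCompl (hP : P.Semistable)
    (h : ∀ S : HolSubbundle F W, P.Invariant S → S.degree = 0 →
      ∃ T : HolSubbundle F W, P.Invariant T ∧ ∀ x, IsCompl (S.fiber x) (T.fiber x)) :
    P.Polystable := by
  refine ⟨hP, fun 𝒲 lam hw hlt hN hd => ?_⟩
  have hinvIco : ∀ j ∈ Finset.Ico 1 𝒲.k, P.Invariant (𝒲.sub j) := fun j hj x =>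
    hw.twistedInvariant hj (hlt j hj) (hN x)
  have hinv : ∀ j ≤ 𝒲.k, P.Invariant (𝒲.sub j) := fun j hj x => by
    rcases Nat.eq_zero_or_pos j with rfl | hj0
    · rw [𝒲.bot]; exact twistedInvariant_bot _
    · rcases hj.lt_or_eq with hjk | rfl
      · exact hinvIco j (Finset.mem_Ico.2 ⟨hj0, hjk⟩) x
      · rw [𝒲.top]; exact twistedInvariant_top _
  have hdeg : ∀ i < 𝒲.k, (𝒲.sub i).degree = 0 := fun j hj => by
    rcases Nat.eq_zero_or_pos j with rfl | hj0
    · exact HolSubbundle.degree_eq_zero_of_fiber_eq_bot 𝒲.bot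
    · have hjI : j ∈ Finset.Ico 1 𝒲.k := Finset.mem_Ico.2 ⟨hj0, hj⟩
      -- By semistability d is a sum of nonnegative terms, so d = 0 kills each one; strict increase
      -- of the weights lets the factor λ_j - λ_{j+1} be cancelled.
      have hz := (Finset.sum_eq_zero_iff_of_nonneg fun i hi =>
        hw.mul_degree_nonneg hi fun _ => hP.degree_nonpos (hinvIco i hi)).1 hd j hjI
      have := (mul_eq_zero.1 hz).resolve_left (sub_neg.2 (hlt j hjI)).ne
      exact_mod_cast this
  have hcompl : ∀ j, ∃ T : HolSubbundle F W, j < 𝒲.k →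
      P.Invariant T ∧ ∀ x, IsCompl (T.fiber x) ((𝒲.sub j).fiber x) := fun j => by
    by_cases hj : j < 𝒲.k
    · obtain ⟨T, hT, hc⟩ := h _ (hinv j hj.le) (hdeg j hj)
      exact ⟨T, fun _ => ⟨hT, fun x => (hc x).symm⟩⟩
    -- A filler beyond the filtration, so that complements can be chosen for all natural indices.
    · exact ⟨HolSubbundle.zero F W, fun h => absurd h hj⟩
  choose T hT using hcompl
  obtain ⟨e, he⟩ := exists_splitting_of_complements 𝒲 T fun i hi => (hT i hi).2
  refine ⟨e, fun i x => ?_⟩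
  rw [he]
  -- The i-th summand is T_i ∩ W_{i+1}, an intersection of two invariant subspaces.
  exact P.twistedInvariant_inf ((hT i i.2).1 x) (hinv (i + 1) i.2 x)

end HiggsPair
end Characterization

end SLHiggs

end

theorem mainTheorem11
    {X : Type*} [TopologicalSpace X] [T2Space X] [CompactSpace X] [ConnectedSpace X]
    [ChartedSpace ℂ X] [IsManifold 𝓘(ℂ, ℂ) ω X]
    (L : X → Type*) [∀ x, AddCommGroup (L x)] [∀ x, Module ℂ (L x)]
    [∀ x, TopologicalSpace (L x)] [TopologicalSpace (TotalSpace ℂ L)] [FiberBundle ℂ L]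
    [VectorBundle ℂ ℂ L] [ContMDiffVectorBundle ω ℂ L 𝓘(ℂ, ℂ)]
    (F : Type*) [NormedAddCommGroup F] [NormedSpace ℂ F] [FiniteDimensional ℂ F]
    (W : X → Type*) [∀ x, AddCommGroup (W x)] [∀ x, Module ℂ (W x)]
    [∀ x, TopologicalSpace (W x)] [TopologicalSpace (TotalSpace F W)] [FiberBundle F W]
    [VectorBundle ℂ F W] [ContMDiffVectorBundle ω F W 𝓘(ℂ, ℂ)]
    (P : SLHiggs.HiggsPair F W L) :
    (P.Semistable ↔
      ∀ S : SLHiggs.HolSubbundle F W, P.Invariant S → S.degree ≤ 0) ∧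
    (P.Stable ↔
      ∀ S : SLHiggs.HolSubbundle F W, S.fiber ≠ ⊥ → S.fiber ≠ ⊤ → P.Invariant S →
        S.degree < 0) ∧
    (P.Polystable ↔
      P.Semistable ∧
        ∀ S : SLHiggs.HolSubbundle F W, P.Invariant S → S.degree = 0 →
          ∃ T : SLHiggs.HolSubbundle F W, P.Invariant T ∧
            ∀ x, IsCompl (S.fiber x) (T.fiber x)) := by
  refine ⟨⟨fun h S hS => h.degree_nonpos hS, fun h =>
      SLHiggs.HiggsPair.semistable_of_degree_nonpos fun S _ _ hS => h S hS⟩,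
    ⟨fun h S h0 h1 hS => h.degree_neg h0 h1 hS, SLHiggs.HiggsPair.stable_of_degree_neg⟩,
    ⟨fun h => ⟨h.1, fun S hS hdeg => h.exists_isCompl hS hdeg⟩,
      fun h => SLHiggs.HiggsPair.polystable_of_exists_isCompl h.1 h.2⟩⟩
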